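/- **Setting.** Let $\mathbb{R}^p=\prod_{j=1}^n\mathbb{R}^{p_j}$ and $\mathbb{R}^d=\prod_{i=1}^m\mathbb{R}^{d_i}$ carry the Euclidean norm, let $f(x)=\sum_{j=1}^n f_j(x_j)$ and $g(y)=\sum_{i=1}^m g_i(y_i)$ with all $f_j:\mathbb{R}^{p_j}\to\mathbb{R}\cup\{+\infty\}$ and $g_i:\mathbb{R}^{d_i}\to\mathbb{R}\cup\{+\infty\}$ proper, closed and convex, let $h:\mathbb{R}^p\to\mathbb{R}$ be convex and differentiable, and let $K\in\mathbb{R}^{d\times p}$. Suppose that for every block $j$ there is $L_j^h\ge 0$ with $\|\nabla_{x_j}h(x+U_jv)-\nabla_{x_j}h(x)\|\le L_j^h\|v\|$ for all $x\in\mathbb{R}^p$, $v\in\mathbb{R}^{p_j}$, where $U_jv$ is the vector with $j$-th block $v$ and zeros elsewhere. Put $\phi=f+h$, and consider $$F^\star=\min_x\{F(x)=\phi(x)+g(Kx)\},\qquad G^\star=\min_y\{G(y)=\phi^*(-K^\top y)+g^*(y)\}.$$ Assume that the primal problem has a solution, that $0\in\mathrm{ri}(\mathrm{dom}\,g-K\,\mathrm{dom}\,\phi)$,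 and that $g$ is finite and $M_g$-Lipschitz continuous on $\mathbb{R}^d$. **Parameters.** Let $q\in\mathbb{R}^n_{++}$ and $\hat q\in\mathbb{R}^m_{++}$ be probability vectors, $\sigma\in\mathbb{R}^n_{++}$, $\rho_0>0$, $\tau_0=\min\{\min_i\hat q_i,\min_jq_j\}$, $\bar L_\sigma=\|K\,\mathrm{diag}(1/\sqrt\sigma)\|^2$ (spectral norm; the $j$-th block is scaled by $1/\sqrt{\sigma_j}$), $L^h_\sigma=\max_jL^h_j/\sigma_j$, and assume that $L^h_\sigma$ and $\bar L_\sigma$ are not both $0$. Let $c>1$ with $c\tau_0>1$, and for $k\ge 0$ set $$\tau_k=\frac{c\tau_0}{k+c},\quad \rho_k=\frac{\rho_0\tau_0}{\tau_k},\quad \gamma_k=\frac1{4\rho_k},\quad \beta_k=\frac{1}{L^h_\sigma+4\bar L_\sigma\rho_k},\quad \eta_k=\frac{\rho_k}{2}.$$ **Algorithm 1.** Start from $\hat y^0\in\mathbb{R}^d$ and $x^0\in\mathbb{R}^p$ with $F(x^0)<+\infty$, and put $\tilde x^0=x^0$, $\tilde r^0=r^0=Kx^0$. For $k=0,1,2,\dots$,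 put $\hat r^k=(1-\tau_k)r^k+\tau_k\tilde r^k$ and $\hat x^k=(1-\tau_k)x^k+\tau_k\tilde x^k$; draw indices $i_k\in[m]$ and $j_k\in[n]$, independent of each other and of all earlier draws, with $\mathbb{P}(i_k=i)=\hat q_i$ and $\mathbb{P}(j_k=j)=q_j$; with $\hat\Delta_r^k=-\hat y^k+\rho_k(\hat r^k-K\hat x^k)$ and $\hat\Delta_x^k=\nabla h(\hat x^k)+K^\top(\hat y^k+\rho_k(K\hat x^k-\hat r^k))$, update only the blocks $$\tilde r^{k+1}_{i}=\mathrm{prox}_{\tau_0\gamma_kg_i/\tau_k}\Big(\tilde r^k_i-\tfrac{\tau_0\gamma_k}{\tau_k}\hat\Delta^k_{r_i}\Big)\ (i=i_k),\qquad \tilde x^{k+1}_{j}=\mathrm{prox}_{\tau_0\beta_kf_j/(\tau_k\sigma_j)}\Big(\tilde x^k_j-\tfrac{\tau_0\beta_k}{\tau_k\sigma_j}\hat\Delta^k_{x_j}\Big)\ (j=j_k),$$ keeping all other blocks of $\tilde r^k$ and $\tilde x^k$; finally put $r^{k+1}=\hat r^k+\frac{\tau_k}{\tau_0}(\tilde r^{k+1}-\tilde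 r^k)$, $x^{k+1}=\hat x^k+\frac{\tau_k}{\tau_0}(\tilde x^{k+1}-\tilde x^k)$ and $\hat y^{k+1}=\hat y^k+\eta_k[Kx^{k+1}-r^{k+1}-(1-\tau_k)(Kx^k-r^k)]$. **Theorem 3.2.** For every $k\ge 0$, $F(x^k)$ is almost surely finite and integrable, and for every primal solution $x^\star$ and every dual solution $y^\star$, $$\mathbb{E}[F(x^k)-F^\star]\le\frac{c\,\mathcal{E}_0^2+(M_g+\|y^\star\|)\,\mathcal{E}_0\,c\sqrt{2c/\rho_0}}{k+c-1},$$ where $\mathcal E_0\ge 0$ and $$\mathcal{E}_0^2=F(x^0)-F^\star+\frac1{\rho_0}\|\hat y^0-y^\star\|^2+\frac{(L^h_\sigma+4\rho_0\bar L_\sigma)\tau_0}{2}\sum_{j=1}^n\frac{\sigma_j}{q_j}\|x^0_j-x^\star_j\|^2+2\tau_0\rho_0\sum_{i=1}^m\frac{1}{\hat q_i}\|(K(x^0-x^\star))_i\|^2.$$ Simultaneously, $$\liminf_{k\to\infty}\ k\sqrt{\log k}\cdot\mathbb{E}[F(x^k)-F^\star]=0,$$ that is, $\mathbb{E}[F(x^k)]-F^\star=\underline{o}\big(1/(k\sqrt{\log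 k})\big)$, where $u_k=\underline{o}(v_k)$ means $\liminf_{k\to\infty}u_k/v_k=0$. -/

import Mathlib

open MeasureTheory ProbabilityTheory Filter
open scoped NNReal ENNReal RealInnerProductSpace Pointwise Gradient

noncomputable section

namespace RandomizedPD

/-! ### Extended-valued convex functions -/

section Convex

variable {E : Type*} [NormedAddCommGroup E] [InnerProductSpace ℝ E]

/-- Effective domain of an extended-valued function. -/
def effDom (f : E → EReal) : Set E := {x | f x < ⊤}

/-- Proper, closed (lower semicontinuous) and convex functions `E → ℝ ∪ {+∞}`. -/
structure ProperClosedConvex (f : E → EReal) : Prop where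
  ne_bot : ∀ x, f x ≠ ⊥
  dom_nonempty : (effDom f).Nonempty
  closed : LowerSemicontinuous f
  convex : ∀ x y : E, ∀ a b : ℝ, 0 ≤ a → 0 ≤ b → a + b = 1 →
    f (a • x + b • y) ≤ (a : EReal) * f x + (b : EReal) * f y

/-- Fenchel conjugate `f^*(z) = sup_x (⟨z, x⟩ - f x)`. -/
def conjugate (f : E → EReal) (z : E) : EReal := ⨆ x, ((⟪z, x⟫ : ℝ) : EReal) - f x

/-- `u` minimizes `v ↦ f v + (1/2) ‖v - x‖²`. -/
def IsProx (f : E → EReal) (x u : E) : Prop :=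
  ∀ v, f u + ((1 / 2 * ‖u - x‖ ^ 2 : ℝ) : EReal) ≤ f v + ((1 / 2 * ‖v - x‖ ^ 2 : ℝ) : EReal)

/-- The proximal operator; for proper closed convex `f` on a finite-dimensional space the
minimizer exists and is unique. -/
def prox (f : E → EReal) (x : E) : E := Classical.epsilon (IsProx f x)

/-- `M`-Lipschitz continuity of an extended-valued function on the whole space; for a proper
function it forces all values to be finite. -/
def LipschitzExt (M : ℝ≥0) (f : E → EReal) : Prop :=
  ∀ x y, f x ≤ f y + ((M * ‖x - y‖ : ℝ) : EReal)

end Convex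

/-! ### Block spaces -/

/-- `ℝ^{p_1 + ... + p_n}` with its block structure and its Euclidean norm. -/
abbrev BlockSpace {n : ℕ} (p : Fin n → ℕ) : Type :=
  PiLp 2 (fun j : Fin n => EuclideanSpace ℝ (Fin (p j)))

/-- Squared weighted norm `∑_j w_j ‖x_j‖²`. -/
def wNormSq {n : ℕ} {p : Fin n → ℕ} (w : Fin n → ℝ) (x : BlockSpace p) : ℝ :=
  ∑ j, w j * ‖x j‖ ^ 2

/-- The block-diagonal operator `x ↦ (w_j x_j)_j`. -/
def blockDiag {n : ℕ} (p : Fin n → ℕ) (w : Fin n → ℝ) : BlockSpace p →L[ℝ] BlockSpace p :=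
  LinearMap.toContinuousLinearMap
    { toFun := fun x => WithLp.toLp 2 (fun j => w j • x j)
      map_add' := fun x y => by ext j; simp
      map_smul' := fun a x => by ext j; simp [mul_left_comm] }

/-- Replace the `j`-th block of `x` by `u`. -/
def setBlock {n : ℕ} {p : Fin n → ℕ} (x : BlockSpace p) (j : Fin n)
    (u : EuclideanSpace ℝ (Fin (p j))) : BlockSpace p :=
  WithLp.toLp 2 (Function.update (fun l => x l) j u)

/-! ### The primal and dual problems -/

/-- Data of `min_x f(x) + h(x) + g(Kx)` with `f(x) = ∑_j f_j(x_j)`, `g(y) = ∑_i g_i(y_i)`. -/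
structure Problem (n m : ℕ) where
  p : Fin n → ℕ
  d : Fin m → ℕ
  f : (j : Fin n) → EuclideanSpace ℝ (Fin (p j)) → EReal
  g : (i : Fin m) → EuclideanSpace ℝ (Fin (d i)) → EReal
  h : BlockSpace p → ℝ
  K : BlockSpace p →L[ℝ] BlockSpace d

namespace Problem

variable {n m : ℕ} (P : Problem n m)

def fSum (x : BlockSpace P.p) : EReal := ∑ j, P.f j (x j)

def gSum (y : BlockSpace P.d) : EReal := ∑ i, P.g i (y i)

def phi (x : BlockSpace P.p) : EReal := P.fSum x + (P.h x : EReal)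

/-- Primal objective. -/
def F (x : BlockSpace P.p) : EReal := P.phi x + P.gSum (P.K x)

/-- Primal optimal value. -/
def Fstar : EReal := ⨅ x, P.F x

/-- Transpose of `K`. -/
def KT : BlockSpace P.d →L[ℝ] BlockSpace P.p := ContinuousLinearMap.adjoint P.K

/-- Dual objective (to be minimized). -/
def G (y : BlockSpace P.d) : EReal := conjugate P.phi (-(P.KT y)) + conjugate P.gSum y

def primalSolutions : Set (BlockSpace P.p) := {x | ∀ z, P.F x ≤ P.F z}

def dualSolutions : Set (BlockSpace P.d) := {y | ∀ z, P.G y ≤ P.G z}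

/-- The standing assumption; `L j` is the partial smoothness constant of `h` in block `j`. -/
structure Assumption (L : Fin n → ℝ) : Prop where
  f_pcc : ∀ j, ProperClosedConvex (P.f j)
  g_pcc : ∀ i, ProperClosedConvex (P.g i)
  h_convex : ConvexOn ℝ Set.univ P.h
  h_diff : Differentiable ℝ P.h
  L_nonneg : ∀ j, 0 ≤ L j
  h_smooth : ∀ (x : BlockSpace P.p) (j : Fin n) (v : EuclideanSpace ℝ (Fin (P.p j))),
    ‖(∇ P.h (x + PiLp.single 2 j v)) j - (∇ P.h x) j‖ ≤ L j * ‖v‖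
  solution : P.primalSolutions.Nonempty
  slater : (0 : BlockSpace P.d) ∈
    intrinsicInterior ℝ (effDom P.gSum - P.K '' effDom P.phi)

end Problem

/-! ### Parameters -/

/-- User-chosen parameters: weights `σ`, sampling distributions `q` on `[n]` and `qh` on `[m]`,
smoothness constants `L` of `h`, and the scalars `c` and `ρ₀`. -/
structure Params (n m : ℕ) where
  σ : Fin n → ℝ
  q : Fin n → ℝ
  qh : Fin m → ℝ
  L : Fin n → ℝ
  c : ℝ
  ρ₀ : ℝ

namespace Params

variable {n m : ℕ} (S : Params n m)

/-- `τ₀ = min {min_i qh_i, min_j q_j}`. -/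
def τ₀ : ℝ := min (⨅ i, S.qh i) (⨅ j, S.q j)

/-- `L^h_σ = max_j L_j / σ_j`. -/
def Lhσ : ℝ := ⨆ j, S.L j / S.σ j

/-- `‖K diag(1/√σ)‖²`, with the spectral norm. -/
def Lbar (P : Problem n m) : ℝ := ‖P.K ∘L blockDiag P.p (fun j => 1 / √(S.σ j))‖ ^ 2

def τ (k : ℕ) : ℝ := S.c * S.τ₀ / (k + S.c)

def ρ (k : ℕ) : ℝ := S.ρ₀ * S.τ₀ / S.τ k

def γ (k : ℕ) : ℝ := 1 / (4 * S.ρ k)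

def β (P : Problem n m) (k : ℕ) : ℝ := 1 / (S.Lhσ + 4 * S.Lbar P * S.ρ k)

def η (k : ℕ) : ℝ := S.ρ k / 2

/-- Positivity of the parameters, `q` and `qh` are probability vectors, and `c > 1`. -/
structure Admissible : Prop where
  σ_pos : ∀ j, 0 < S.σ j
  q_pos : ∀ j, 0 < S.q j
  qh_pos : ∀ i, 0 < S.qh i
  q_sum : ∑ j, S.q j = 1
  qh_sum : ∑ i, S.qh i = 1
  ρ₀_pos : 0 < S.ρ₀
  one_lt_c : 1 < S.c

end Params

/-! ### The fully randomized primal-dual algorithm -/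

/-- The variables `(x^k, x̃^k, r^k, r̃^k, ŷ^k, ȳ^k)`. -/
structure State {n m : ℕ} (P : Problem n m) where
  x : BlockSpace P.p
  xt : BlockSpace P.p
  r : BlockSpace P.d
  rt : BlockSpace P.d
  yh : BlockSpace P.d
  yb : BlockSpace P.d

section Algorithm

variable {n m : ℕ} (P : Problem n m) (S : Params n m)

/-- Initial state from `(x⁰, ŷ⁰)`. -/
def initState (x0 : BlockSpace P.p) (y0 : BlockSpace P.d) : State P where
  x := x0
  xt := x0
  r := P.K x0
  rt := P.K x0
  yh := y0
  yb := y0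

/-- One iteration with counter `k` and sampled indices `i = i_k`, `j = j_k`. -/
def step (k : ℕ) (i : Fin m) (j : Fin n) (s : State P) : State P :=
  let τ := S.τ k
  let rh := (1 - τ) • s.r + τ • s.rt
  let xh := (1 - τ) • s.x + τ • s.xt
  let Δr := -s.yh + S.ρ k • (rh - P.K xh)
  let Δx := ∇ P.h xh + P.KT (s.yh + S.ρ k • (P.K xh - rh))
  let a := S.τ₀ * S.γ k / τ
  let b := S.τ₀ * S.β P k / (τ * S.σ j)
  let rt' := setBlock s.rt i (prox (fun u => (a : EReal) * P.g i u) (s.rt i - a • Δr i))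
  let xt' := setBlock s.xt j (prox (fun u => (b : EReal) * P.f j u) (s.xt j - b • Δx j))
  let r' := rh + (τ / S.τ₀) • (rt' - s.rt)
  let x' := xh + (τ / S.τ₀) • (xt' - s.xt)
  { x := x'
    xt := xt'
    r := r'
    rt := rt'
    yh := s.yh + S.η k • (P.K x' - r' - (1 - τ) • (P.K s.x - s.r))
    yb := (1 - τ) • s.yb + τ • (s.yh + S.ρ k • (P.K xh - rh)) }

/-- The iterates, driven by the index sequences `i_0, i_1, …` and `j_0, j_1, …`. -/
def iterate (x0 : BlockSpace P.p) (y0 : BlockSpace P.d) (is : ℕ → Fin m) (js : ℕ → Fin n) :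
    ℕ → State P
  | 0 => initState P x0 y0
  | k + 1 => step P S k (is k) (js k) (iterate x0 y0 is js k)

/-- The constant `E₀²`, for a primal solution `xs` and a dual solution `ys`. -/
def E0sq (x0 : BlockSpace P.p) (y0 : BlockSpace P.d)
    (xs : BlockSpace P.p) (ys : BlockSpace P.d) : ℝ :=
  (P.F x0 - P.Fstar).toReal + 1 / S.ρ₀ * ‖y0 - ys‖ ^ 2
    + (S.Lhσ + 4 * S.ρ₀ * S.Lbar P) * S.τ₀ / 2 * wNormSq (fun j => S.σ j / S.q j) (x0 - xs)
    + 2 * S.τ₀ * S.ρ₀ * wNormSq (fun i => 1 / S.qh i) (P.K (x0 - xs))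

end Algorithm

/-- The random indices: at every iteration `i_k` has law `qh`, `j_k` has law `q`, they are
independent of each other, and the pairs `(i_k, j_k)` are independent over `k`. -/
structure Sampling {n m : ℕ} (S : Params n m) {Ω : Type*} [MeasurableSpace Ω] (μ : Measure Ω)
    (is : ℕ → Ω → Fin m) (js : ℕ → Ω → Fin n) : Prop where
  meas_i : ∀ k, Measurable (is k)
  meas_j : ∀ k, Measurable (js k)
  law_i : ∀ k i, μ.real {ω | is k ω = i} = S.qh i
  law_j : ∀ k j, μ.real {ω | js k ω = j} = S.q j
  indep_ij : ∀ k, IndepFun (is k) (js k) μ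
  indep_iter : iIndepFun (fun k ω => (is k ω, js k ω)) μ

/-- `u_k = o(v_k)` in the liminf sense: `liminf_k u_k / v_k = 0`. The liminf is taken in the
extended reals, so that it has no default value for unbounded sequences. -/
def SmallOLiminf (u v : ℕ → ℝ) : Prop :=
  liminf (fun k => ((u k / v k : ℝ) : EReal)) atTop = 0

end RandomizedPD

end

open MeasureTheory ProbabilityTheory Filter
open scoped NNReal ENNReal RealInnerProductSpace Pointwise Gradient

noncomputable section

namespace RandomizedPD

/-! ### Proper closed convex functions and their proximal operators -/

section ProperClosedConvex

variable {E : Type*} [NormedAddCommGroup E] [InnerProductSpace ℝ E] {f : E → EReal}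

theorem ProperClosedConvex.coe_toReal (hf : ProperClosedConvex f) {x : E} (hx : x ∈ effDom f) :
    ((f x).toReal : EReal) = f x :=
  EReal.coe_toReal (ne_of_lt hx) (hf.ne_bot x)

theorem ProperClosedConvex.convexOn_toReal (hf : ProperClosedConvex f) :
    ConvexOn ℝ (effDom f) (fun x => (f x).toReal) := by
  have key : ∀ x ∈ effDom f, ∀ y ∈ effDom f, ∀ a b : ℝ, 0 ≤ a → 0 ≤ b → a + b = 1 →
      f (a • x + b • y) ≤ ((a * (f x).toReal + b * (f y).toReal : ℝ) : EReal) := by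
    intro x hx y hy a b ha hb hab
    have h := hf.convex x y a b ha hb hab
    rw [← hf.coe_toReal hx, ← hf.coe_toReal hy] at h
    exact_mod_cast h
  have hconv : Convex ℝ (effDom f) := fun x hx y hy a b ha hb hab =>
    lt_of_le_of_lt (key x hx y hy a b ha hb hab) (EReal.coe_lt_top _)
  refine ⟨hconv, fun x hx y hy a b ha hb hab => ?_⟩
  have h := key x hx y hy a b ha hb hab
  rw [← hf.coe_toReal (hconv hx hy ha hb hab)] at h
  exact_mod_cast h

/-- A proper closed convex function is bounded below by a function of linear growth. -/
theorem ProperClosedConvex.exists_linear_lower_bound [ProperSpace E] (hf : ProperClosedConvex f)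
    {x₀ : E} (hx₀ : x₀ ∈ effDom f) :
    ∃ C : ℝ, 0 ≤ C ∧ ∀ v ∈ effDom f, -(C * (1 + ‖v - x₀‖)) ≤ (f v).toReal := by
  obtain ⟨z, hz, hmin⟩ := LowerSemicontinuousOn.exists_isMinOn (s := Metric.closedBall x₀ 1)
    ⟨x₀, by simp⟩ (isCompact_closedBall x₀ 1) (hf.closed.lowerSemicontinuousOn _)
  have hz' : z ∈ effDom f :=
    lt_of_le_of_lt (b := f x₀) (hmin (show x₀ ∈ Metric.closedBall x₀ 1 by simp)) hx₀
  have hball : ∀ v ∈ effDom f, ‖v - x₀‖ ≤ 1 → (f z).toReal ≤ (f v).toReal := by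
    intro v hv hv1
    have := hmin (show v ∈ Metric.closedBall x₀ 1 by simpa [dist_eq_norm] using hv1)
    simp only [Set.mem_ofPred_eq] at this
    rw [← hf.coe_toReal hv, ← hf.coe_toReal hz'] at this
    exact_mod_cast this
  refine ⟨|(f z).toReal| + |(f x₀).toReal|, by positivity, fun v hv => ?_⟩
  have h1 := neg_abs_le (f z).toReal
  have h2 := abs_nonneg (f x₀).toReal
  have h3 := le_abs_self (f x₀).toReal
  have h4 := abs_nonneg (f z).toReal
  rcases le_or_gt ‖v - x₀‖ 1 with hv1 | hv1
  · have := hball v hv hv1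
    nlinarith [norm_nonneg (v - x₀)]
  · set R := ‖v - x₀‖ with hR
    have hR0 : 0 < R := by linarith
    have ht : (1 : ℝ) - R⁻¹ + R⁻¹ = 1 := by ring
    have ht0 : 0 ≤ 1 - R⁻¹ := by
      have := inv_le_one_of_one_le₀ hv1.le
      linarith
    have hc := hf.convexOn_toReal.2 hx₀ hv ht0 (inv_nonneg.2 hR0.le) ht
    have hm := hf.convexOn_toReal.1 hx₀ hv ht0 (inv_nonneg.2 hR0.le) ht
    have hn : ‖(1 - R⁻¹) • x₀ + R⁻¹ • v - x₀‖ ≤ 1 := by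
      have : (1 - R⁻¹) • x₀ + R⁻¹ • v - x₀ = R⁻¹ • (v - x₀) := by module
      rw [this, norm_smul, ← hR, Real.norm_eq_abs, abs_of_nonneg (inv_nonneg.2 hR0.le),
        inv_mul_cancel₀ hR0.ne']
    have hlow := (hball _ hm hn).trans hc
    simp only [smul_eq_mul] at hlow
    have hmul := mul_le_mul_of_nonneg_left hlow hR0.le
    have e : R * ((1 - R⁻¹) * (f x₀).toReal + R⁻¹ * (f v).toReal)
        = (R - 1) * (f x₀).toReal + (f v).toReal := by
      field_simp
    rw [e] at hmul
    nlinarith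

theorem ProperClosedConvex.exists_isProx [ProperSpace E] (hf : ProperClosedConvex f) {b : ℝ}
    (hb : 0 < b) (x : E) : ∃ u, IsProx (fun v => (b : EReal) * f v) x u := by
  obtain ⟨x₀, hx₀⟩ := hf.dom_nonempty
  obtain ⟨C, hC, hlow⟩ := hf.exists_linear_lower_bound hx₀
  set Φ : E → EReal := fun v => f v + ((1 / (2 * b) * ‖v - x‖ ^ 2 : ℝ) : EReal) with hΦ
  have hlsc : LowerSemicontinuous Φ := by
    refine LowerSemicontinuous.add' hf.closed ?_ fun v => ?_
    · exact (continuous_coe_real_ereal.comp (by fun_prop)).lowerSemicontinuous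
    · exact EReal.continuousAt_add (Or.inr (EReal.coe_ne_bot _)) (Or.inr (EReal.coe_ne_top _))
  -- outside of a large ball the objective exceeds its value at `x₀`
  obtain ⟨R, hR0, hR⟩ : ∃ R : ℝ, 0 ≤ R ∧ ∀ v ∈ effDom f, R < ‖v - x₀‖ →
      (f x₀).toReal + 1 / (2 * b) * ‖x₀ - x‖ ^ 2 ≤ (f v).toReal + 1 / (2 * b) * ‖v - x‖ ^ 2 := by
    set D := ‖x₀ - x‖ with hD
    set A := |(f x₀).toReal| + C * (1 + D) with hA
    have hD0 : 0 ≤ D := norm_nonneg _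
    have hA0 : 0 ≤ A := by positivity
    refine ⟨2 * D + 2 * b * (C + A) + 1, by positivity, fun v hv hv1 => ?_⟩
    have h1 := hlow v hv
    have h2 : ‖v - x₀‖ - D ≤ ‖v - x‖ := by
      have : ‖v - x₀‖ ≤ ‖v - x‖ + ‖x - x₀‖ := norm_sub_le_norm_sub_add_norm_sub _ _ _
      rw [norm_sub_rev x x₀] at this
      linarith
    set r := ‖v - x₀‖ - D with hr
    have hr1 : D + 2 * b * (C + A) + 1 < r := by linarith
    have hr0 : 0 ≤ r := by
      have : 0 ≤ 2 * b * (C + A) := by positivity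
      linarith
    have h3 : r ^ 2 ≤ ‖v - x‖ ^ 2 := by gcongr
    have hbb : 0 ≤ 1 / (2 * b) := by positivity
    have h4 : 1 / (2 * b) * (D ^ 2 + 2 * b * (C + A) * r) ≤ 1 / (2 * b) * r ^ 2 := by
      refine mul_le_mul_of_nonneg_left ?_ hbb
      have : 0 ≤ 2 * b * (C + A) := by positivity
      nlinarith
    have e : 1 / (2 * b) * (D ^ 2 + 2 * b * (C + A) * r)
        = 1 / (2 * b) * D ^ 2 + (C + A) * r := by field_simp
    have h5 := mul_le_mul_of_nonneg_left h3 hbb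
    have h6 := le_abs_self (f x₀).toReal
    have h7 : A ≤ A * r := by
      have : 1 ≤ r := by
        have : 0 ≤ 2 * b * (C + A) := by positivity
        linarith
      nlinarith
    have h8 : ‖v - x₀‖ = r + D := by simp [hr]
    rw [h8] at h1
    nlinarith
  obtain ⟨u, hu, hmin⟩ := LowerSemicontinuousOn.exists_isMinOn (s := Metric.closedBall x₀ R)
    ⟨x₀, by simp [hR0]⟩ (isCompact_closedBall x₀ R) (hlsc.lowerSemicontinuousOn _)
  have hux₀ : Φ u ≤ Φ x₀ := hmin (by simp [hR0])
  have hglob : ∀ v, Φ u ≤ Φ v := by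
    intro v
    by_cases hv : v ∈ effDom f
    · rcases le_or_gt ‖v - x₀‖ R with h | h
      · exact hmin (by simpa [dist_eq_norm] using h)
      · refine hux₀.trans ?_
        simp only [hΦ]
        rw [← hf.coe_toReal hv, ← hf.coe_toReal hx₀]
        exact_mod_cast hR v hv h
    · have : f v = ⊤ := by simpa [effDom] using hv
      simp only [hΦ, this, EReal.top_add_coe, le_top]
  refine ⟨u, fun v => ?_⟩
  have hudom : u ∈ effDom f := by
    by_contra h
    have h' : f u = ⊤ := by simpa [effDom] using h
    have h'' := hglob x₀
    simp only [hΦ, h', EReal.top_add_coe, top_le_iff] at h''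
    rw [← hf.coe_toReal hx₀] at h''
    exact (EReal.coe_ne_top _) (by exact_mod_cast h'')
  by_cases hv : v ∈ effDom f
  · have h := hglob v
    simp only [hΦ] at h
    rw [← hf.coe_toReal hv, ← hf.coe_toReal hudom] at h
    have h' : (f u).toReal + 1 / (2 * b) * ‖u - x‖ ^ 2
        ≤ (f v).toReal + 1 / (2 * b) * ‖v - x‖ ^ 2 := by exact_mod_cast h
    have h2 := mul_le_mul_of_nonneg_left h' hb.le
    have e : ∀ s t : ℝ, b * (s + 1 / (2 * b) * t) = b * s + 1 / 2 * t := by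
      intro s t; field_simp
    rw [e, e] at h2
    simp only
    rw [← hf.coe_toReal hv, ← hf.coe_toReal hudom]
    exact_mod_cast h2
  · have : f v = ⊤ := by simpa [effDom] using hv
    simp only [this, EReal.coe_mul_top_of_pos hb, EReal.top_add_coe, le_top]

theorem ProperClosedConvex.isProx_prox [ProperSpace E] (hf : ProperClosedConvex f) {b : ℝ}
    (hb : 0 < b) (x : E) :
    IsProx (fun v => (b : EReal) * f v) x (prox (fun v => (b : EReal) * f v) x) :=
  Classical.epsilon_spec (hf.exists_isProx hb x)

theorem ProperClosedConvex.mem_effDom_of_isProx (hf : ProperClosedConvex f) {b : ℝ} (hb : 0 < b)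
    {x u : E} (hu : IsProx (fun v => (b : EReal) * f v) x u) : u ∈ effDom f := by
  obtain ⟨x₀, hx₀⟩ := hf.dom_nonempty
  by_contra h
  have h' : f u = ⊤ := by simpa [effDom] using h
  have h'' := hu x₀
  simp only [h', EReal.coe_mul_top_of_pos hb, EReal.top_add_coe, top_le_iff] at h''
  rw [← hf.coe_toReal hx₀] at h''
  exact (EReal.coe_ne_top _) (by exact_mod_cast h'')

/-- The variational inequality characterizing a proximal point. -/
theorem ProperClosedConvex.isProx_variational (hf : ProperClosedConvex f) {b : ℝ} (hb : 0 < b)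
    {x u : E} (hu : IsProx (fun v => (b : EReal) * f v) x u) {z : E} (hz : z ∈ effDom f) :
    b * (f u).toReal + ⟪x - u, z - u⟫ ≤ b * (f z).toReal := by
  have hud := hf.mem_effDom_of_isProx hb hu
  have key : ∀ t : ℝ, 0 < t → t ≤ 1 →
      b * (f u).toReal + ⟪x - u, z - u⟫ - b * (f z).toReal ≤ t / 2 * ‖z - u‖ ^ 2 := by
    intro t ht ht1
    have hab : 1 - t + t = 1 := by ring
    have hm := hf.convexOn_toReal.1 hud hz (sub_nonneg.2 ht1) ht.le hab
    have hc := hf.convexOn_toReal.2 hud hz (sub_nonneg.2 ht1) ht.le hab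
    simp only [smul_eq_mul] at hc
    have h := hu ((1 - t) • u + t • z)
    simp only at h
    rw [← hf.coe_toReal hud, ← hf.coe_toReal hm] at h
    have h' : b * (f u).toReal + 1 / 2 * ‖u - x‖ ^ 2 ≤
        b * (f ((1 - t) • u + t • z)).toReal + 1 / 2 * ‖(1 - t) • u + t • z - x‖ ^ 2 := by
      exact_mod_cast h
    have e : (1 - t) • u + t • z - x = (u - x) + t • (z - u) := by module
    rw [e, norm_add_sq_real, inner_smul_right, norm_smul, mul_pow, Real.norm_eq_abs, sq_abs] at h'
    have e2 : ⟪x - u, z - u⟫ = -⟪u - x, z - u⟫ := by rw [← inner_neg_left, neg_sub]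
    rw [e2]
    have h2 := mul_le_mul_of_nonneg_left hc hb.le
    have h3 : t * (b * (f u).toReal + -⟪u - x, z - u⟫ - b * (f z).toReal)
        ≤ t * (t / 2 * ‖z - u‖ ^ 2) := by nlinarith
    exact le_of_mul_le_mul_left h3 ht
  have hlim : Tendsto (fun t : ℝ => t / 2 * ‖z - u‖ ^ 2) (nhdsWithin 0 (Set.Ioi 0)) (nhds 0) := by
    have : Tendsto (fun t : ℝ => t / 2 * ‖z - u‖ ^ 2) (nhds 0) (nhds (0 / 2 * ‖z - u‖ ^ 2)) :=
      Continuous.tendsto (by fun_prop) 0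
    simpa using this.mono_left nhdsWithin_le_nhds
  have := ge_of_tendsto hlim (b := b * (f u).toReal + ⟪x - u, z - u⟫ - b * (f z).toReal) (by
    filter_upwards [Ioc_mem_nhdsGT (zero_lt_one' ℝ)] with t ht
    exact key t ht.1 ht.2)
  linarith

end ProperClosedConvex

/-! ### First-order inequalities for differentiable functions -/

section FirstOrder

variable {E : Type*} [NormedAddCommGroup E] [InnerProductSpace ℝ E] [CompleteSpace E] {h : E → ℝ}

theorem hasDerivAt_comp_add_smul (hd : Differentiable ℝ h) (x v : E) (t : ℝ) :
    HasDerivAt (fun s : ℝ => h (x + s • v)) ⟪∇ h (x + t • v), v⟫ t := by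
  have h1 : HasDerivAt (fun s : ℝ => x + s • v) v t := by
    simpa using ((hasDerivAt_id t).smul_const v).const_add x
  have h2 := (hd (x + t • v)).hasFDerivAt.comp_hasDerivAt t h1
  rw [inner_gradient_left]
  exact h2

theorem inner_gradient_le_sub (hd : Differentiable ℝ h) (hc : ConvexOn ℝ Set.univ h) (x z : E) :
    h x + ⟪∇ h x, z - x⟫ ≤ h z := by
  have h1 := hasDerivAt_comp_add_smul hd x (z - x) 0
  have h2 : ConvexOn ℝ Set.univ (fun s : ℝ => h (x + s • (z - x))) := by
    refine ⟨convex_univ, fun s _ t _ a b ha hb hab => ?_⟩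
    have := hc.2 (Set.mem_univ (x + s • (z - x))) (Set.mem_univ (x + t • (z - x))) ha hb hab
    convert this using 2
    have : x = (a + b) • x := by rw [hab, one_smul]
    nth_rewrite 1 [this]
    simp only [smul_eq_mul]
    module
  have h3 := h2.le_slope_of_hasDerivAt (Set.mem_univ 0) (Set.mem_univ 1) zero_lt_one h1
  simp only [slope_def_field, zero_smul, add_zero, one_smul, sub_zero, div_one,
    add_sub_cancel] at h3
  linarith

theorem le_of_inner_gradient_sub_le (hd : Differentiable ℝ h) (x v : E) {C : ℝ}
    (hC : ∀ t : ℝ, 0 ≤ t → ⟪∇ h (x + t • v) - ∇ h x, v⟫ ≤ C * t) :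
    h (x + v) ≤ h x + ⟪∇ h x, v⟫ + C / 2 := by
  have hder : ∀ t : ℝ, HasDerivAt (fun s : ℝ => h (x + s • v) - s * ⟪∇ h x, v⟫ - C / 2 * s ^ 2)
      (⟪∇ h (x + t • v), v⟫ - ⟪∇ h x, v⟫ - C * t) t := by
    intro t
    have h1 := hasDerivAt_comp_add_smul hd x v t
    have h2 := (hasDerivAt_id t).mul_const ⟪∇ h x, v⟫
    have h3 := ((hasDerivAt_id t).pow 2).const_mul (C / 2)
    exact ((h1.sub h2).sub h3).congr_deriv (by norm_num; ring)
  have hanti : AntitoneOn (fun s : ℝ => h (x + s • v) - s * ⟪∇ h x, v⟫ - C / 2 * s ^ 2)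
      (Set.Ici 0) := by
    refine antitoneOn_of_deriv_nonpos (convex_Ici 0)
      (fun t _ => (hder t).continuousAt.continuousWithinAt)
      (fun t _ => (hder t).differentiableAt.differentiableWithinAt) fun t ht => ?_
    rw [(hder t).deriv]
    have := hC t (interior_subset ht)
    rw [inner_sub_left] at this
    linarith
  have := hanti (Set.mem_Ici.2 le_rfl) (Set.mem_Ici.2 zero_le_one) zero_le_one
  simp only [one_smul, one_mul, one_pow, mul_one, zero_smul, add_zero, zero_mul, sub_zero,
    ne_eq, OfNat.ofNat_ne_zero, not_false_eq_true, zero_pow, mul_zero] at this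
  linarith

end FirstOrder

/-! ### Fenchel duality for a continuous outer function -/

theorem exists_saddle_multiplier {X Y : Type*} [NormedAddCommGroup X] [NormedSpace ℝ X]
    [NormedAddCommGroup Y] [InnerProductSpace ℝ Y] [CompleteSpace Y] {D : Set X} {φ : X → ℝ}
    (hφ : ConvexOn ℝ D φ) {g : Y → ℝ} (hg : ConvexOn ℝ Set.univ g) (hgc : Continuous g)
    (K : X →L[ℝ] Y) {Fs : ℝ} (hlow : ∀ x ∈ D, Fs ≤ φ x + g (K x)) {xs : X} (hxs : xs ∈ D)
    (hFs : φ xs + g (K xs) = Fs) :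
    ∃ y : Y, ∀ x ∈ D, ∀ r, Fs ≤ φ x + g r + ⟪y, K x - r⟫ := by
  set A : Set (Y × ℝ) := {a | ∃ x ∈ D, φ x + g (K x + a.1) < a.2} with hA
  have hopen : IsOpen A := by
    have : A = ⋃ x ∈ D, {a : Y × ℝ | φ x + g (K x + a.1) < a.2} := by
      ext a; simp [hA]
    rw [this]
    exact isOpen_biUnion fun x _ => isOpen_lt (by fun_prop) continuous_snd
  have hconv : Convex ℝ A := by
    rintro ⟨u, s⟩ ⟨x, hx, h1⟩ ⟨v, t⟩ ⟨z, hz, h2⟩ a b ha hb hab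
    refine ⟨a • x + b • z, hφ.1 hx hz ha hb hab, ?_⟩
    have c1 := hφ.2 hx hz ha hb hab
    have c2 := hg.2 (Set.mem_univ (K x + u)) (Set.mem_univ (K z + v)) ha hb hab
    have e : K (a • x + b • z) + (a • u + b • v) = a • (K x + u) + b • (K z + v) := by
      simp only [map_add, map_smul]; module
    simp only [smul_eq_mul, Prod.smul_mk, Prod.mk_add_mk] at *
    rw [e]
    rcases ha.eq_or_lt with rfl | ha'
    · have : b = 1 := by linarith
      subst this
      linarith
    · nlinarith
  have hnot : ((0 : Y), Fs) ∉ A := by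
    rintro ⟨x, hx, h⟩
    simp only [add_zero] at h
    exact absurd (hlow x hx) (not_le.2 h)
  obtain ⟨ℓ, hℓ⟩ := geometric_hahn_banach_open_point hconv hopen hnot
  set s : ℝ := ℓ (0, 1) with hs
  have hsplit : ∀ (u : Y) (t : ℝ), ℓ (u, t) = ℓ (u, 0) + t * s := by
    intro u t
    have : ((u, t) : Y × ℝ) = (u, 0) + t • ((0 : Y), (1 : ℝ)) := by simp
    rw [this, map_add, map_smul, smul_eq_mul]
  have hs0 : s < 0 := by
    have := hℓ (0, Fs + 1) ⟨xs, hxs, by simp [hFs]⟩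
    rw [hsplit 0 (Fs + 1), hsplit 0 Fs] at this
    linarith
  set y : Y := (InnerProductSpace.toDual ℝ Y).symm
    ((-s⁻¹) • ℓ.comp (ContinuousLinearMap.inl ℝ Y ℝ)) with hy
  have hyu : ∀ u : Y, ⟪y, u⟫ = -s⁻¹ * ℓ (u, 0) := by
    intro u
    rw [hy, InnerProductSpace.toDual_symm_apply]
    simp
  refine ⟨y, fun x hx r => le_of_forall_pos_le_add fun ε hε => ?_⟩
  have h := hℓ (r - K x, φ x + g r + ε) ⟨x, hx, by simpa using hε⟩
  rw [hsplit _ (φ x + g r + ε), hsplit 0 Fs] at h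
  have h0 : ℓ ((0 : Y), (0 : ℝ)) = 0 := map_zero ℓ
  have hneg : K x - r = -(r - K x) := by abel
  rw [hneg, inner_neg_right, hyu]
  have hs' : 0 < -s⁻¹ := by
    have := inv_lt_zero.2 hs0
    linarith
  have h3 := mul_lt_mul_of_pos_left h hs'
  have e1 : s⁻¹ * s = 1 := inv_mul_cancel₀ hs0.ne
  rw [h0] at h3
  have e2 : -s⁻¹ * (ℓ (r - K x, 0) + (φ x + g r + ε) * s)
      = -s⁻¹ * ℓ (r - K x, 0) - (φ x + g r + ε) := by
    linear_combination (-(φ x + g r + ε)) * e1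
  have e3 : -s⁻¹ * (0 + Fs * s) = -Fs := by linear_combination (-Fs) * e1
  rw [e2, e3] at h3
  linarith

/-! ### Averaging of sequences -/

theorem exists_mem_smul_add_smul_eq {V : Type*} [AddCommGroup V] [Module ℝ V] {C : Set V}
    (hC : Convex ℝ C) {a b : ℝ} (ha : 0 ≤ a) (hb : 0 ≤ b) {x y : V} (hx : x ∈ C) (hy : y ∈ C) :
    ∃ z ∈ C, a • x + b • y = (a + b) • z := by
  rcases (add_nonneg ha hb).eq_or_lt with h | h
  · have ha0 : a = 0 := by linarith
    have hb0 : b = 0 := by linarith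
    exact ⟨x, hx, by simp [ha0, hb0]⟩
  · refine ⟨(a / (a + b)) • x + (b / (a + b)) • y,
      hC hx hy (by positivity) (by positivity) (by field_simp), ?_⟩
    rw [smul_add, smul_smul, smul_smul, mul_div_cancel₀ _ h.ne', mul_div_cancel₀ _ h.ne']

/-- The accelerated averages `X k` of points `Z k` of a convex set stay in that set. -/
theorem averaged_mem_of_convex {V : Type*} [AddCommGroup V] [Module ℝ V] {C : Set V}
    (hC : Convex ℝ C) {τ w : ℕ → ℝ} (hτ : ∀ k, τ k ≤ 1) (hw0 : w 0 = 1) (hw : ∀ k, 0 ≤ w k)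
    (hw1 : ∀ k, w k ≤ 1) (hstep : ∀ k, w (k + 1) ≤ (1 - τ k) * w k + τ k) {X Z : ℕ → V}
    (hZ : ∀ k, Z k ∈ C) (h0 : X 0 = Z 0)
    (hX : ∀ k, X (k + 1) = (1 - τ k) • X k + τ k • Z k + w (k + 1) • (Z (k + 1) - Z k)) (k : ℕ) :
    X k ∈ C := by
  have key : ∀ k, ∃ c ∈ C, X k = w k • Z k + (1 - w k) • c := by
    intro k
    induction k with
    | zero => exact ⟨Z 0, hZ 0, by rw [h0, hw0]; simp⟩
    | succ k ih =>
      obtain ⟨c, hc, he⟩ := ih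
      obtain ⟨z, hz, hze⟩ := exists_mem_smul_add_smul_eq hC
        (a := (1 - τ k) * w k + τ k - w (k + 1)) (b := (1 - τ k) * (1 - w k))
        (by linarith [hstep k])
        (mul_nonneg (by linarith [hτ k]) (by linarith [hw1 k])) (hZ k) hc
      refine ⟨z, hz, ?_⟩
      have e : (1 - τ k) * w k + τ k - w (k + 1) + (1 - τ k) * (1 - w k) = 1 - w (k + 1) := by
        ring
      rw [e] at hze
      rw [← hze, hX k, he]
      module
  obtain ⟨c, hc, he⟩ := key k
  rw [he]
  exact hC (hZ k) hc (hw k) (by linarith [hw1 k]) (by ring)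

/-! ### A divergent series -/

theorem not_summable_one_div_mul_log :
    ¬ Summable (fun k : ℕ => 1 / ((k : ℝ) * Real.log k)) := by
  intro h
  have h1 : Summable (fun k : ℕ => 1 / (((max k 2 : ℕ) : ℝ) * Real.log (max k 2 : ℕ))) := by
    refine (summable_nat_add_iff 2).1 (((summable_nat_add_iff 2).2 h).congr fun k => ?_)
    rw [max_eq_left (by omega)]
  rw [← summable_condensed_iff_of_nonneg] at h1
  · have h2 : Summable (fun k : ℕ => (Real.log 2)⁻¹ * (1 / ((k + 1 : ℕ) : ℝ))) := by
      refine ((summable_nat_add_iff 1).2 h1).congr fun k => ?_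
      have : 2 ≤ 2 ^ (k + 1) := by
        calc 2 = 2 ^ 1 := rfl
          _ ≤ 2 ^ (k + 1) := Nat.pow_le_pow_right (by norm_num) (by omega)
      rw [max_eq_left this]
      push_cast
      rw [Real.log_pow]
      have : Real.log 2 ≠ 0 := (Real.log_pos (by norm_num)).ne'
      push_cast
      field_simp
    have h3 := (summable_mul_left_iff (inv_ne_zero (Real.log_pos (by norm_num)).ne')).1 h2
    exact Real.not_summable_one_div_natCast ((summable_nat_add_iff 1).1 h3)
  · intro k
    have : (2 : ℝ) ≤ (max k 2 : ℕ) := by exact_mod_cast le_max_right k 2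
    have := Real.log_nonneg (x := (max k 2 : ℕ)) (by linarith)
    positivity
  · intro a b _ hab
    have ha : (2 : ℝ) ≤ (max a 2 : ℕ) := by exact_mod_cast le_max_right a 2
    have hb : ((max a 2 : ℕ) : ℝ) ≤ (max b 2 : ℕ) := by
      exact_mod_cast max_le_max_right 2 hab
    have hl : 0 < Real.log (max a 2 : ℕ) := Real.log_pos (by linarith)
    have hl' := Real.log_le_log (by linarith) hb
    gcongr

/-- If `∑ a_k` and `∑ k b_k²` converge and `a_k = O(1/k)`, then `a_k + b_k` is frequently smaller
than any multiple of `1 / (k √(log k))`. -/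
theorem frequently_mul_sqrt_log_lt {a b : ℕ → ℝ} {A : ℝ} (ha0 : ∀ k, 0 ≤ a k)
    (ha : Summable a) (haA : ∀ k : ℕ, k * a k ≤ A) (hb : Summable fun k : ℕ => k * b k ^ 2)
    {ε : ℝ} (hε : 0 < ε) :
    ∃ᶠ k : ℕ in atTop, k * √(Real.log k) * (a k + b k) < ε := by
  intro hcon
  have hev : ∀ᶠ k : ℕ in atTop,
      ε ^ 2 * (1 / ((k : ℝ) * Real.log k)) ≤ 2 * A * a k + 2 * (k * b k ^ 2) := by
    filter_upwards [hcon, eventually_ge_atTop 2] with k hk hk2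
    have hk' : (2 : ℝ) ≤ k := by exact_mod_cast hk2
    have hl : 0 < Real.log k := Real.log_pos (by linarith)
    have h1 : ε ^ 2 ≤ (k * √(Real.log k) * (a k + b k)) ^ 2 := by
      have := not_lt.1 hk
      gcongr
    have h2 : (k * √(Real.log k) * (a k + b k)) ^ 2
        = (k * Real.log k) * (k * (a k + b k) ^ 2) := by
      rw [mul_pow, mul_pow, Real.sq_sqrt hl.le]; ring
    rw [h2] at h1
    have h3 : (k : ℝ) * (a k + b k) ^ 2 ≤ 2 * A * a k + 2 * (k * b k ^ 2) := by
      have := mul_le_mul_of_nonneg_right (haA k) (ha0 k)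
      nlinarith [mul_nonneg (by linarith : (0 : ℝ) ≤ k) (sq_nonneg (a k - b k))]
    have hpos : 0 < (k : ℝ) * Real.log k := by positivity
    rw [mul_one_div, div_le_iff₀ hpos]
    calc ε ^ 2 ≤ _ := h1
      _ ≤ (k * Real.log k) * (2 * A * a k + 2 * (k * b k ^ 2)) := by gcongr
      _ = _ := by ring
  have hsum : Summable fun k : ℕ => 2 * A * a k + 2 * (k * b k ^ 2) :=
    (ha.mul_left _).add (hb.mul_left _)
  have hs : Summable fun k : ℕ => ε ^ 2 * (1 / ((k : ℝ) * Real.log k)) := by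
    refine hsum.of_norm_bounded_eventually_nat ?_
    filter_upwards [hev, eventually_ge_atTop 2] with k hk hk2
    have hk' : (2 : ℝ) ≤ k := by exact_mod_cast hk2
    have hl : 0 < Real.log k := Real.log_pos (by linarith)
    rw [Real.norm_of_nonneg (by positivity)]
    exact hk
  exact not_summable_one_div_mul_log ((summable_mul_left_iff (by positivity)).1 hs)

/-! ### Expectations along randomly driven recursions -/

section Recursion

variable {n m : ℕ} {α : Type*}

/-- The orbit of `a₀` under the maps `stp k (is k) (js k)`. -/
def orbit (stp : ℕ → Fin m → Fin n → α → α) (a₀ : α) (is : ℕ → Fin m) (js : ℕ → Fin n) : ℕ → α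
  | 0 => a₀
  | k + 1 => stp k (is k) (js k) (orbit stp a₀ is js k)

theorem orbit_congr (stp : ℕ → Fin m → Fin n → α → α) (a₀ : α) {is is' : ℕ → Fin m}
    {js js' : ℕ → Fin n} (k : ℕ) (hi : ∀ l < k, is l = is' l) (hj : ∀ l < k, js l = js' l) :
    orbit stp a₀ is js k = orbit stp a₀ is' js' k := by
  induction k with
  | zero => rfl
  | succ k ih =>
    simp only [orbit]
    rw [ih (fun l hl => hi l (by omega)) (fun l hl => hj l (by omega)), hi k (by omega),
      hj k (by omega)]

/-- The orbit at time `k` factors through the first `k` index pairs. -/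
theorem exists_orbit_eq_history {Ω : Type*} [hΩ : Nonempty Ω] (is : ℕ → Ω → Fin m)
    (js : ℕ → Ω → Fin n) (stp : ℕ → Fin m → Fin n → α → α) (a₀ : α) (k : ℕ) :
    ∃ T : ((Finset.range k) → Fin m × Fin n) → α, ∀ ω,
      orbit stp a₀ (fun l => is l ω) (fun l => js l ω) k
        = T (fun l => (is l ω, js l ω)) := by
  obtain ⟨ω₀⟩ : Nonempty Ω := hΩ
  refine ⟨fun H => orbit stp a₀
    (fun l => if hl : l ∈ Finset.range k then (H ⟨l, hl⟩).1 else is 0 ω₀)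
    (fun l => if hl : l ∈ Finset.range k then (H ⟨l, hl⟩).2 else js 0 ω₀) k, fun ω => ?_⟩
  refine orbit_congr stp a₀ k (fun l hl => ?_) fun l hl => ?_ <;> simp [hl]

variable {S : Params n m} {Ω : Type*} [MeasurableSpace Ω] {μ : Measure Ω}
  [IsProbabilityMeasure μ] {is : ℕ → Ω → Fin m} {js : ℕ → Ω → Fin n}

theorem measurable_orbit (hsamp : Sampling S μ is js) (stp : ℕ → Fin m → Fin n → α → α)
    (a₀ : α) (Φ : α → ℝ) (k : ℕ) :
    Measurable (fun ω => Φ (orbit stp a₀ (fun l => is l ω) (fun l => js l ω) k)) := by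
  have := μ.nonempty_of_neZero
  obtain ⟨T, hT⟩ := exists_orbit_eq_history is js stp a₀ k
  simp only [hT]
  have h1 : Measurable (fun H : ((Finset.range k) → Fin m × Fin n) => Φ (T H)) :=
    measurable_of_finite _
  exact h1.comp (measurable_pi_lambda _ fun l =>
    (hsamp.meas_i l).prodMk (hsamp.meas_j l))

theorem integrable_orbit (hsamp : Sampling S μ is js) (stp : ℕ → Fin m → Fin n → α → α)
    (a₀ : α) (Φ : α → ℝ) (k : ℕ) :
    Integrable (fun ω => Φ (orbit stp a₀ (fun l => is l ω) (fun l => js l ω) k)) μ := by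
  have := μ.nonempty_of_neZero
  obtain ⟨T, hT⟩ := exists_orbit_eq_history is js stp a₀ k
  obtain ⟨C, hC⟩ := (Set.finite_range fun H => ‖Φ (T H)‖).bddAbove
  refine Integrable.of_bound (measurable_orbit hsamp stp a₀ Φ k).aestronglyMeasurable C
    (Eventually.of_forall fun ω => ?_)
  simp only [hT]
  exact hC ⟨_, rfl⟩

theorem integral_orbit_succ (hsamp : Sampling S μ is js) (stp : ℕ → Fin m → Fin n → α → α)
    (a₀ : α) (Φ : α → ℝ) (k : ℕ) :
    ∫ ω, Φ (orbit stp a₀ (fun l => is l ω) (fun l => js l ω) (k + 1)) ∂μ =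
      ∫ ω, ∑ i, ∑ j, S.qh i * S.q j *
        Φ (stp k i j (orbit stp a₀ (fun l => is l ω) (fun l => js l ω) k)) ∂μ := by
  have := μ.nonempty_of_neZero
  obtain ⟨T, hT⟩ := exists_orbit_eq_history is js stp a₀ k
  have hmeas : ∀ l, Measurable (fun ω => (is l ω, js l ω)) := fun l =>
    (hsamp.meas_i l).prodMk (hsamp.meas_j l)
  have hind : IndepFun (fun ω (l : Finset.range k) => (is l ω, js l ω))
      (fun ω (l : ({k} : Finset ℕ)) => (is l ω, js l ω)) μ :=
    hsamp.indep_iter.indepFun_finset (Finset.range k) {k} (by simp) hmeas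
  have hprob : ∀ i j, ∫ ω, (if is k ω = i ∧ js k ω = j then (1 : ℝ) else 0) ∂μ
      = S.qh i * S.q j := by
    intro i j
    have h1 : (fun ω => if is k ω = i ∧ js k ω = j then (1 : ℝ) else 0)
        = fun ω => (if is k ω = i then (1 : ℝ) else 0) * (if js k ω = j then (1 : ℝ) else 0) := by
      funext ω
      by_cases h : is k ω = i <;> by_cases h' : js k ω = j <;> simp [h, h']
    have mi : Measurable (fun a : Fin m => if a = i then (1 : ℝ) else 0) := measurable_of_finite _
    have mj : Measurable (fun a : Fin n => if a = j then (1 : ℝ) else 0) := measurable_of_finite _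
    have h2 := ((hsamp.indep_ij k).comp mi mj).integral_fun_mul_eq_mul_integral
      (mi.comp (hsamp.meas_i k)).aestronglyMeasurable
      (mj.comp (hsamp.meas_j k)).aestronglyMeasurable
    have h3 : ∫ ω, (if is k ω = i then (1 : ℝ) else 0) ∂μ = S.qh i := by
      have hm : MeasurableSet {ω | is k ω = i} :=
        (hsamp.meas_i k) (measurableSet_singleton i)
      rw [← hsamp.law_i k i, ← integral_indicator_one hm]
      congr with ω
      simp [Set.indicator]
    have h4 : ∫ ω, (if js k ω = j then (1 : ℝ) else 0) ∂μ = S.q j := by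
      have hm : MeasurableSet {ω | js k ω = j} :=
        (hsamp.meas_j k) (measurableSet_singleton j)
      rw [← hsamp.law_j k j, ← integral_indicator_one hm]
      congr with ω
      simp [Set.indicator]
    rw [h1, ← h3, ← h4]
    exact h2
  have hprod : ∀ i j, ∫ ω, Φ (stp k i j (T fun l => (is l ω, js l ω)))
      * (if is k ω = i ∧ js k ω = j then (1 : ℝ) else 0) ∂μ
      = ∫ ω, S.qh i * S.q j * Φ (stp k i j (T fun l => (is l ω, js l ω))) ∂μ := by
    intro i j
    have m1 : Measurable (fun H : ((Finset.range k) → Fin m × Fin n) => Φ (stp k i j (T H))) :=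
      measurable_of_finite _
    have m2 : Measurable (fun H : (({k} : Finset ℕ) → Fin m × Fin n) =>
        if (H ⟨k, by simp⟩).1 = i ∧ (H ⟨k, by simp⟩).2 = j then (1 : ℝ) else 0) :=
      measurable_of_finite _
    have h2 := (hind.comp m1 m2).integral_fun_mul_eq_mul_integral
      (m1.comp (measurable_pi_lambda _ fun l => hmeas l)).aestronglyMeasurable
      (m2.comp (measurable_pi_lambda _ fun l => hmeas l)).aestronglyMeasurable
    rw [integral_const_mul, ← hprob i j, mul_comm]
    exact h2
  have hsplit : ∀ ω, Φ (orbit stp a₀ (fun l => is l ω) (fun l => js l ω) (k + 1))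
      = ∑ i, ∑ j, Φ (stp k i j (T fun l => (is l ω, js l ω)))
        * (if is k ω = i ∧ js k ω = j then (1 : ℝ) else 0) := by
    intro ω
    rw [Finset.sum_eq_single (is k ω), Finset.sum_eq_single (js k ω)]
    · simp [orbit, hT]
    · intro j _ hj
      simp [hj.symm]
    · simp
    · intro i _ hi
      simp [hi.symm]
    · simp
  have hint : ∀ i j, Integrable (fun ω => Φ (stp k i j (T fun l => (is l ω, js l ω)))) μ := by
    intro i j
    have := integrable_orbit hsamp stp a₀ (fun a => Φ (stp k i j a)) k
    simpa only [hT] using this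
  have hint' : ∀ i j, Integrable (fun ω => Φ (stp k i j (T fun l => (is l ω, js l ω)))
      * (if is k ω = i ∧ js k ω = j then (1 : ℝ) else 0)) μ := by
    intro i j
    refine (hint i j).mul_bdd (c := 1) ?_ (Eventually.of_forall fun ω => ?_)
    · have m2 : Measurable (fun a : Fin m × Fin n =>
        if a.1 = i ∧ a.2 = j then (1 : ℝ) else 0) := measurable_of_finite _
      exact (m2.comp (hmeas k)).aestronglyMeasurable
    · split_ifs <;> simp
  simp only [hsplit, hT]
  rw [integral_finsetSum _ fun i _ => integrable_finsetSum _ fun j _ => hint' i j,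
    integral_finsetSum _ fun i _ => integrable_finsetSum _ fun j _ => (hint i j).const_mul _]
  refine Finset.sum_congr rfl fun i _ => ?_
  rw [integral_finsetSum _ fun j _ => hint' i j,
    integral_finsetSum _ fun j _ => (hint i j).const_mul _]
  exact Finset.sum_congr rfl fun j _ => hprod i j

end Recursion

/-! ### The problem on its effective domain -/

namespace Problem

variable {n m : ℕ} (P : Problem n m)

/-- The domain of `x ↦ ∑ j, f_j (x_j)`. -/
def dom : Set (BlockSpace P.p) := {x | ∀ j, x j ∈ effDom (P.f j)}

/-- Real values of `∑ j, f_j (x_j)`. -/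
def fReal (x : BlockSpace P.p) : ℝ := ∑ j, (P.f j (x j)).toReal

/-- Real values of `∑ i, g_i (r_i)`. -/
def gReal (r : BlockSpace P.d) : ℝ := ∑ i, (P.g i (r i)).toReal

end Problem

theorem sum_ne_bot {ι : Type*} (s : Finset ι) {a : ι → EReal} (h : ∀ i ∈ s, a i ≠ ⊥) :
    ∑ i ∈ s, a i ≠ ⊥ := by
  classical
  induction s using Finset.induction_on with
  | empty => simp
  | insert i s hi ih =>
    rw [Finset.sum_insert hi]
    refine EReal.add_ne_bot_iff.2 ⟨h i (by simp), ih fun l hl => h l (by simp [hl])⟩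

theorem sum_lt_top_iff {ι : Type*} (s : Finset ι) {a : ι → EReal} (h : ∀ i ∈ s, a i ≠ ⊥) :
    ∑ i ∈ s, a i < ⊤ ↔ ∀ i ∈ s, a i < ⊤ := by
  classical
  induction s using Finset.induction_on with
  | empty => simp
  | insert i s hi ih =>
    have h1 : a i ≠ ⊥ := h i (by simp)
    have h2 : ∀ l ∈ s, a l ≠ ⊥ := fun l hl => h l (by simp [hl])
    rw [Finset.sum_insert hi, lt_top_iff_ne_top, EReal.add_ne_top_iff_ne_top₂ h1 (sum_ne_bot s h2),
      ← lt_top_iff_ne_top, ← lt_top_iff_ne_top, ih h2]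
    simp

theorem sum_eq_coe_sum_toReal {ι : Type*} (s : Finset ι) {a : ι → EReal} (h : ∀ i ∈ s, a i ≠ ⊥)
    (h' : ∀ i ∈ s, a i < ⊤) : ∑ i ∈ s, a i = ((∑ i ∈ s, (a i).toReal : ℝ) : EReal) := by
  classical
  induction s using Finset.induction_on with
  | empty => simp
  | insert i s hi ih =>
    rw [Finset.sum_insert hi, Finset.sum_insert hi, EReal.coe_add,
      ih (fun l hl => h l (by simp [hl])) (fun l hl => h' l (by simp [hl])),
      EReal.coe_toReal (h' i (by simp)).ne (h i (by simp))]

namespace Problem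

variable {n m : ℕ} {P : Problem n m} {L : Fin n → ℝ} {M : ℝ≥0}

theorem Assumption.fSum_eq (hP : P.Assumption L) {x : BlockSpace P.p} (hx : x ∈ P.dom) :
    P.fSum x = P.fReal x :=
  sum_eq_coe_sum_toReal _ (fun j _ => (hP.f_pcc j).ne_bot _) fun j _ => hx j

theorem Assumption.fSum_lt_top_iff (hP : P.Assumption L) {x : BlockSpace P.p} :
    P.fSum x < ⊤ ↔ x ∈ P.dom :=
  (sum_lt_top_iff _ fun j _ => (hP.f_pcc j).ne_bot _).trans (by simp [dom, effDom])

theorem Assumption.g_lt_top (hP : P.Assumption L) (hg : LipschitzExt M P.gSum) (i : Fin m)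
    (u : EuclideanSpace ℝ (Fin (P.d i))) : u ∈ effDom (P.g i) := by
  choose y hy using fun i => (hP.g_pcc i).dom_nonempty
  have hb : ∀ z : BlockSpace P.d, ∀ i ∈ Finset.univ, P.g i (z i) ≠ ⊥ :=
    fun z i _ => (hP.g_pcc i).ne_bot _
  have h1 : P.gSum (WithLp.toLp 2 y) < ⊤ :=
    (sum_lt_top_iff _ (hb _)).2 fun i _ => hy i
  have h2 : P.gSum (setBlock (WithLp.toLp 2 y) i u) < ⊤ :=
    lt_of_le_of_lt (hg _ (WithLp.toLp 2 y)) (EReal.add_lt_top h1.ne (EReal.coe_ne_top _))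
  have h3 := (sum_lt_top_iff _ (hb _)).1 h2 i (Finset.mem_univ i)
  have h4 : P.g i u < ⊤ := by simpa [setBlock] using h3
  exact h4

theorem Assumption.gSum_eq (hP : P.Assumption L) (hg : LipschitzExt M P.gSum)
    (r : BlockSpace P.d) : P.gSum r = P.gReal r :=
  sum_eq_coe_sum_toReal _ (fun i _ => (hP.g_pcc i).ne_bot _) fun i _ => hP.g_lt_top hg i _

theorem Assumption.phi_eq (hP : P.Assumption L) {x : BlockSpace P.p} (hx : x ∈ P.dom) :
    P.phi x = ((P.fReal x + P.h x : ℝ) : EReal) := by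
  rw [phi, hP.fSum_eq hx, EReal.coe_add]

theorem Assumption.phi_eq_top (hP : P.Assumption L) {x : BlockSpace P.p} (hx : x ∉ P.dom) :
    P.phi x = ⊤ := by
  have : P.fSum x = ⊤ := by
    by_contra h
    exact hx (hP.fSum_lt_top_iff.1 (lt_top_iff_ne_top.2 h))
  rw [phi, this, EReal.top_add_coe]

theorem Assumption.F_eq (hP : P.Assumption L) (hg : LipschitzExt M P.gSum) {x : BlockSpace P.p}
    (hx : x ∈ P.dom) : P.F x = ((P.fReal x + P.h x + P.gReal (P.K x) : ℝ) : EReal) := by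
  rw [F, hP.phi_eq hx, hP.gSum_eq hg, ← EReal.coe_add]

theorem Assumption.F_lt_top_iff (hP : P.Assumption L) (hg : LipschitzExt M P.gSum)
    {x : BlockSpace P.p} : P.F x < ⊤ ↔ x ∈ P.dom := by
  refine ⟨fun h => ?_, fun h => by rw [hP.F_eq hg h]; exact EReal.coe_lt_top _⟩
  by_contra hx
  rw [F, hP.phi_eq_top hx, hP.gSum_eq hg, EReal.top_add_coe] at h
  exact lt_irrefl _ h

theorem Fstar_eq {xs : BlockSpace P.p} (hxs : xs ∈ P.primalSolutions) : P.Fstar = P.F xs :=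
  le_antisymm (iInf_le _ xs) (le_iInf hxs)

theorem Assumption.mem_dom_of_primalSolutions (hP : P.Assumption L)
    (hg : LipschitzExt M P.gSum) {x0 xs : BlockSpace P.p} (hx0 : P.F x0 < ⊤)
    (hxs : xs ∈ P.primalSolutions) : xs ∈ P.dom :=
  (hP.F_lt_top_iff hg).1 (lt_of_le_of_lt (hxs x0) hx0)

theorem Assumption.Fstar_toReal_le (hP : P.Assumption L) (hg : LipschitzExt M P.gSum)
    {xs : BlockSpace P.p} (hxs : xs ∈ P.primalSolutions) (hxsd : xs ∈ P.dom)
    {x : BlockSpace P.p} (hx : x ∈ P.dom) :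
    P.Fstar.toReal ≤ P.fReal x + P.h x + P.gReal (P.K x) := by
  have h := hxs x
  rw [hP.F_eq hg hx, hP.F_eq hg hxsd] at h
  rw [Fstar_eq hxs, hP.F_eq hg hxsd, EReal.toReal_coe]
  exact_mod_cast h

theorem Assumption.Fstar_toReal_eq (hP : P.Assumption L) (hg : LipschitzExt M P.gSum)
    {xs : BlockSpace P.p} (hxs : xs ∈ P.primalSolutions) (hxsd : xs ∈ P.dom) :
    P.Fstar.toReal = P.fReal xs + P.h xs + P.gReal (P.K xs) := by
  rw [Fstar_eq hxs, hP.F_eq hg hxsd, EReal.toReal_coe]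

theorem Assumption.convexOn_fReal (hP : P.Assumption L) : ConvexOn ℝ P.dom P.fReal := by
  refine ⟨fun x hx y hy a b ha hb hab j => ?_, fun x hx y hy a b ha hb hab => ?_⟩
  · exact (hP.f_pcc j).convexOn_toReal.1 (hx j) (hy j) ha hb hab
  · simp only [fReal, smul_eq_mul, Finset.mul_sum, ← Finset.sum_add_distrib]
    exact Finset.sum_le_sum fun j _ =>
      (hP.f_pcc j).convexOn_toReal.2 (hx j) (hy j) ha hb hab

theorem Assumption.convexOn_gReal (hP : P.Assumption L) (hg : LipschitzExt M P.gSum) :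
    ConvexOn ℝ Set.univ P.gReal := by
  refine ⟨convex_univ, fun x _ y _ a b ha hb hab => ?_⟩
  simp only [gReal, smul_eq_mul, Finset.mul_sum, ← Finset.sum_add_distrib]
  exact Finset.sum_le_sum fun i _ => (hP.g_pcc i).convexOn_toReal.2
    (hP.g_lt_top hg i (x i)) (hP.g_lt_top hg i (y i)) ha hb hab

theorem Assumption.gReal_le (hP : P.Assumption L) (hg : LipschitzExt M P.gSum)
    (r s : BlockSpace P.d) : P.gReal r ≤ P.gReal s + M * ‖r - s‖ := by
  have h := hg r s
  rw [hP.gSum_eq hg, hP.gSum_eq hg] at h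
  exact_mod_cast h

theorem Assumption.continuous_gReal (hP : P.Assumption L) (hg : LipschitzExt M P.gSum) :
    Continuous P.gReal := by
  refine (LipschitzWith.of_le_add_mul M fun r s => ?_).continuous
  rw [dist_eq_norm]
  exact hP.gReal_le hg r s

/-- `y` is a Lagrange multiplier: the Lagrangian is bounded below by the optimal value. -/
def IsMultiplier (P : Problem n m) (y : BlockSpace P.d) : Prop :=
  ∀ x ∈ P.dom, ∀ r, P.Fstar.toReal ≤ P.fReal x + P.h x + P.gReal r + ⟪y, P.K x - r⟫

theorem inner_neg_KT (y : BlockSpace P.d) (x : BlockSpace P.p) :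
    ⟪-(P.KT y), x⟫ = -⟪y, P.K x⟫ := by
  rw [inner_neg_left, KT, ContinuousLinearMap.adjoint_inner_left]

theorem Assumption.exists_isMultiplier (hP : P.Assumption L) (hg : LipschitzExt M P.gSum)
    {x0 : BlockSpace P.p} (hx0 : P.F x0 < ⊤) : ∃ y, P.IsMultiplier y := by
  obtain ⟨xs, hxs⟩ := hP.solution
  have hxsd := hP.mem_dom_of_primalSolutions hg hx0 hxs
  exact exists_saddle_multiplier (D := P.dom) (φ := fun x => P.fReal x + P.h x)
    (hP.convexOn_fReal.add (hP.h_convex.subset (Set.subset_univ _) hP.convexOn_fReal.1))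
    (hP.convexOn_gReal hg) (hP.continuous_gReal hg) P.K
    (fun x hx => hP.Fstar_toReal_le hg hxs hxsd hx) hxsd (hP.Fstar_toReal_eq hg hxs hxsd).symm

theorem Assumption.G_le_of_isMultiplier (hP : P.Assumption L) (hg : LipschitzExt M P.gSum)
    {x0 : BlockSpace P.p} (hx0 : P.F x0 < ⊤) {y : BlockSpace P.d} (hy : P.IsMultiplier y) :
    P.G y ≤ ((-P.Fstar.toReal : ℝ) : EReal) := by
  have hx0d := (hP.F_lt_top_iff hg).1 hx0
  have h1 : ∀ r, conjugate P.phi (-(P.KT y)) ≤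
      ((-P.Fstar.toReal - (⟪y, r⟫ - P.gReal r) : ℝ) : EReal) := by
    intro r
    refine iSup_le fun x => ?_
    by_cases hx : x ∈ P.dom
    · rw [hP.phi_eq hx, inner_neg_KT, ← EReal.coe_sub]
      have := hy x hx r
      rw [inner_sub_right] at this
      exact EReal.coe_le_coe_iff.2 (by linarith)
    · rw [hP.phi_eq_top hx, EReal.sub_top]
      exact bot_le
  have hbot : conjugate P.phi (-(P.KT y)) ≠ ⊥ := by
    intro h
    have := le_iSup (fun x => ((⟪-(P.KT y), x⟫ : ℝ) : EReal) - P.phi x) x0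
    rw [← conjugate, h, hP.phi_eq hx0d, ← EReal.coe_sub, le_bot_iff] at this
    exact EReal.coe_ne_bot _ this
  have htop : conjugate P.phi (-(P.KT y)) ≠ ⊤ :=
    (lt_of_le_of_lt (h1 0) (EReal.coe_lt_top _)).ne
  rw [G]
  set a := (conjugate P.phi (-(P.KT y))).toReal with ha
  have hae : conjugate P.phi (-(P.KT y)) = a := (EReal.coe_toReal htop hbot).symm
  have h2 : conjugate P.gSum y ≤ ((-P.Fstar.toReal - a : ℝ) : EReal) := by
    refine iSup_le fun r => ?_
    have := h1 r
    rw [hae, EReal.coe_le_coe_iff] at this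
    rw [hP.gSum_eq hg, ← EReal.coe_sub]
    exact EReal.coe_le_coe_iff.2 (by linarith)
  rw [hae]
  refine (add_le_add le_rfl h2).trans ?_
  rw [← EReal.coe_add]
  exact EReal.coe_le_coe_iff.2 (by linarith)

theorem Assumption.coe_le_G (hP : P.Assumption L) (hg : LipschitzExt M P.gSum)
    {x : BlockSpace P.p} (hx : x ∈ P.dom) (r y : BlockSpace P.d) :
    ((-(P.fReal x + P.h x + P.gReal r + ⟪y, P.K x - r⟫) : ℝ) : EReal) ≤ P.G y := by
  have h1 := le_iSup (fun x => ((⟪-(P.KT y), x⟫ : ℝ) : EReal) - P.phi x) x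
  have h2 := le_iSup (fun r => ((⟪y, r⟫ : ℝ) : EReal) - P.gSum r) r
  have h3 := add_le_add h1 h2
  rw [hP.phi_eq hx, hP.gSum_eq hg, inner_neg_KT, ← EReal.coe_sub, ← EReal.coe_sub,
    ← EReal.coe_add] at h3
  refine le_trans (le_of_eq ?_) h3
  congr 1
  rw [inner_sub_right]
  ring

theorem Assumption.isMultiplier_of_dualSolutions (hP : P.Assumption L)
    (hg : LipschitzExt M P.gSum) {x0 : BlockSpace P.p} (hx0 : P.F x0 < ⊤) {ys : BlockSpace P.d}
    (hys : ys ∈ P.dualSolutions) : P.IsMultiplier ys := by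
  obtain ⟨y, hy⟩ := hP.exists_isMultiplier hg hx0
  intro x hx r
  have h := (hP.coe_le_G hg hx r ys).trans ((hys y).trans (hP.G_le_of_isMultiplier hg hx0 hy))
  have := EReal.coe_le_coe_iff.1 h
  linarith

theorem Assumption.dualSolutions_nonempty (hP : P.Assumption L) (hg : LipschitzExt M P.gSum)
    {x0 : BlockSpace P.p} (hx0 : P.F x0 < ⊤) : P.dualSolutions.Nonempty := by
  obtain ⟨y, hy⟩ := hP.exists_isMultiplier hg hx0
  obtain ⟨xs, hxs⟩ := hP.solution
  have hxsd := hP.mem_dom_of_primalSolutions hg hx0 hxs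
  refine ⟨y, fun z => (hP.G_le_of_isMultiplier hg hx0 hy).trans ?_⟩
  have := hP.coe_le_G hg hxsd (P.K xs) z
  rwa [sub_self, inner_zero_right, add_zero, ← hP.Fstar_toReal_eq hg hxs hxsd] at this

end Problem

/-! ### Blocks -/

section Blocks

variable {n : ℕ} {p : Fin n → ℕ}

theorem sum_setBlock (φ : (l : Fin n) → EuclideanSpace ℝ (Fin (p l)) → ℝ) (x : BlockSpace p)
    (j : Fin n) (u : EuclideanSpace ℝ (Fin (p j))) :
    ∑ l, φ l (setBlock x j u l) = ∑ l, φ l (x l) + (φ j u - φ j (x j)) := by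
  rw [← sub_eq_iff_eq_add', ← Finset.sum_sub_distrib, Finset.sum_eq_single j]
  · simp [setBlock]
  · intro l _ hl
    simp [setBlock, Function.update_of_ne hl]
  · simp

theorem wNormSq_setBlock_sub (w : Fin n → ℝ) (x z : BlockSpace p) (j : Fin n)
    (u : EuclideanSpace ℝ (Fin (p j))) :
    wNormSq w (setBlock x j u - z) =
      wNormSq w (x - z) + w j * (‖u - z j‖ ^ 2 - ‖x j - z j‖ ^ 2) := by
  have := sum_setBlock (fun l v => w l * ‖v - z l‖ ^ 2) x j u
  rw [mul_sub]
  exact this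

theorem setBlock_sub (x : BlockSpace p) (j : Fin n) (u : EuclideanSpace ℝ (Fin (p j))) :
    setBlock x j u - x = PiLp.single 2 j (u - x j) := by
  ext l a
  by_cases hl : l = j
  · subst hl
    simp [setBlock]
  · simp [setBlock, hl]

theorem inner_single_right (a : BlockSpace p) (j : Fin n) (v : EuclideanSpace ℝ (Fin (p j))) :
    ⟪a, (PiLp.single 2 j v : BlockSpace p)⟫ = ⟪a j, v⟫ := by
  rw [PiLp.inner_apply, Finset.sum_eq_single j]
  · simp
  · intro l _ hl
    simp [hl]
  · simp

theorem smul_single (c : ℝ) (j : Fin n) (v : EuclideanSpace ℝ (Fin (p j))) :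
    c • (PiLp.single 2 j v : BlockSpace p) = PiLp.single 2 j (c • v) := by
  ext l a
  by_cases hl : l = j
  · subst hl
    simp
  · simp [hl]

theorem wNormSq_nonneg {w : Fin n → ℝ} (hw : ∀ j, 0 ≤ w j) (x : BlockSpace p) :
    0 ≤ wNormSq w x :=
  Finset.sum_nonneg fun j _ => mul_nonneg (hw j) (sq_nonneg _)

end Blocks

section SmoothBlocks

variable {n m : ℕ} {P : Problem n m}

theorem Problem.Assumption.h_add_single_le {L : Fin n → ℝ} (hP : P.Assumption L)
    (x : BlockSpace P.p) (j : Fin n) (v : EuclideanSpace ℝ (Fin (P.p j))) :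
    P.h (x + PiLp.single 2 j v) ≤ P.h x + ⟪(∇ P.h x) j, v⟫ + L j * ‖v‖ ^ 2 / 2 := by
  have := le_of_inner_gradient_sub_le hP.h_diff x (PiLp.single 2 j v : BlockSpace P.p)
    (C := L j * ‖v‖ ^ 2) fun t ht => ?_
  · rwa [inner_single_right] at this
  · rw [inner_single_right, smul_single]
    refine (real_inner_le_norm _ _).trans
      ((mul_le_mul_of_nonneg_right (hP.h_smooth x j (t • v)) (norm_nonneg v)).trans (le_of_eq ?_))
    rw [norm_smul, Real.norm_of_nonneg ht]
    ring

theorem norm_K_single_sq_le (S : Params n m) (hS : S.Admissible) (j : Fin n)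
    (v : EuclideanSpace ℝ (Fin (P.p j))) :
    ‖P.K (PiLp.single 2 j v)‖ ^ 2 ≤ S.Lbar P * (S.σ j * ‖v‖ ^ 2) := by
  have hσ := hS.σ_pos j
  have e : P.K (PiLp.single 2 j v) = (P.K ∘L blockDiag P.p (fun j => 1 / √(S.σ j)))
      (PiLp.single 2 j (√(S.σ j) • v)) := by
    rw [ContinuousLinearMap.comp_apply]
    congr 1
    ext l a
    by_cases hl : l = j
    · subst hl
      have : √(S.σ l) ≠ 0 := (Real.sqrt_pos.2 hσ).ne'
      simp [blockDiag, this]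
    · simp [blockDiag, hl]
  have h := (P.K ∘L blockDiag P.p (fun j => 1 / √(S.σ j))).le_opNorm
    (PiLp.single 2 j (√(S.σ j) • v))
  rw [← e] at h
  have hn : ‖(PiLp.single 2 j (√(S.σ j) • v) : BlockSpace P.p)‖ = √(S.σ j) * ‖v‖ := by
    rw [PiLp.norm_single, norm_smul, Real.norm_of_nonneg (Real.sqrt_nonneg _)]
  rw [hn] at h
  calc ‖P.K (PiLp.single 2 j v)‖ ^ 2
      ≤ (‖P.K ∘L blockDiag P.p (fun j => 1 / √(S.σ j))‖ * (√(S.σ j) * ‖v‖)) ^ 2 := by gcongr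
    _ = S.Lbar P * (S.σ j * ‖v‖ ^ 2) := by
      rw [mul_pow, mul_pow, Real.sq_sqrt hσ.le, Params.Lbar]

end SmoothBlocks

/-! ### Parameters -/

namespace Params

variable {n m : ℕ} {S : Params n m}

theorem Admissible.nonempty_n (hS : S.Admissible) : Nonempty (Fin n) := by
  by_contra h
  have := not_nonempty_iff.1 h
  simpa using hS.q_sum

theorem Admissible.nonempty_m (hS : S.Admissible) : Nonempty (Fin m) := by
  by_contra h
  have := not_nonempty_iff.1 h
  simpa using hS.qh_sum

theorem τ₀_le_q (S : Params n m) (j : Fin n) : S.τ₀ ≤ S.q j :=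
  (min_le_right _ _).trans (ciInf_le (Set.finite_range _).bddBelow j)

theorem τ₀_le_qh (S : Params n m) (i : Fin m) : S.τ₀ ≤ S.qh i :=
  (min_le_left _ _).trans (ciInf_le (Set.finite_range _).bddBelow i)

theorem Admissible.τ₀_pos (hS : S.Admissible) : 0 < S.τ₀ := by
  have := hS.nonempty_n
  have := hS.nonempty_m
  obtain ⟨i, hi⟩ := exists_eq_ciInf_of_finite (f := S.qh)
  obtain ⟨j, hj⟩ := exists_eq_ciInf_of_finite (f := S.q)
  rw [τ₀, ← hi, ← hj]
  exact lt_min (hS.qh_pos i) (hS.q_pos j)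

theorem Admissible.τ₀_le_one (hS : S.Admissible) : S.τ₀ ≤ 1 := by
  obtain ⟨j⟩ := hS.nonempty_n
  refine (S.τ₀_le_q j).trans ?_
  rw [← hS.q_sum]
  exact Finset.single_le_sum (fun l _ => (hS.q_pos l).le) (Finset.mem_univ j)

theorem Admissible.add_c_pos (hS : S.Admissible) (k : ℕ) : 0 < k + S.c := by
  have := hS.one_lt_c
  positivity

theorem Admissible.τ_pos (hS : S.Admissible) (k : ℕ) : 0 < S.τ k :=
  div_pos (mul_pos (by linarith [hS.one_lt_c]) hS.τ₀_pos) (hS.add_c_pos k)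

theorem Admissible.τ_le_τ₀ (hS : S.Admissible) (k : ℕ) : S.τ k ≤ S.τ₀ := by
  rw [τ, div_le_iff₀ (hS.add_c_pos k)]
  have : (0 : ℝ) ≤ k := by positivity
  nlinarith [hS.τ₀_pos]

theorem Admissible.ρ_pos (hS : S.Admissible) (k : ℕ) : 0 < S.ρ k :=
  div_pos (mul_pos hS.ρ₀_pos hS.τ₀_pos) (hS.τ_pos k)

theorem Admissible.γ_pos (hS : S.Admissible) (k : ℕ) : 0 < S.γ k := by
  have := hS.ρ_pos k
  rw [γ]
  positivity

theorem Admissible.L_le (hS : S.Admissible) (j : Fin n) : S.L j ≤ S.Lhσ * S.σ j := by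
  rw [← div_le_iff₀ (hS.σ_pos j)]
  exact le_ciSup (f := fun j => S.L j / S.σ j) (Set.finite_range _).bddAbove j

theorem Admissible.Lhσ_nonneg (hS : S.Admissible) (hL : ∀ j, 0 ≤ S.L j) : 0 ≤ S.Lhσ :=
  Real.iSup_nonneg fun j => div_nonneg (hL j) (hS.σ_pos j).le

theorem Lbar_nonneg (S : Params n m) (P : Problem n m) : 0 ≤ S.Lbar P := sq_nonneg _

theorem Admissible.inv_β_pos (hS : S.Admissible) {P : Problem n m} (hL : ∀ j, 0 ≤ S.L j)
    (hβ : 0 < S.Lhσ ∨ 0 < S.Lbar P) (k : ℕ) : 0 < S.Lhσ + 4 * S.Lbar P * S.ρ k := by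
  have h1 := hS.Lhσ_nonneg hL
  have h2 := S.Lbar_nonneg P
  have h3 := hS.ρ_pos k
  rcases hβ with h | h <;> positivity

end Params

/-! ### Estimates for one block and for the multiplier -/

/-- The contribution of one randomly updated block, with curvature weight `s`. -/
theorem ProperClosedConvex.block_estimate {E : Type*} [NormedAddCommGroup E]
    [InnerProductSpace ℝ E] {f : E → EReal} (hf : ProperClosedConvex f) {τ τ₀ q s b : ℝ}
    (hτ : 0 < τ) (hτ₀ : 0 < τ₀) (hq : τ₀ ≤ q) (hs : 0 < s) (hb : b = τ₀ / (τ * s)) {x u z Δ : E}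
    (hx : x ∈ effDom f) (hz : z ∈ effDom f)
    (hu : IsProx (fun v => (b : EReal) * f v) (x - b • Δ) u) :
    q * (τ / τ₀ * ((f u).toReal - (f x).toReal + ⟪Δ, u - x⟫)
      + (τ / τ₀) ^ 2 * (s / 2) * ‖u - x‖ ^ 2
      + τ ^ 2 / (2 * τ₀) * (s / q * (‖u - z‖ ^ 2 - ‖x - z‖ ^ 2)))
      ≤ τ * ((f z).toReal - (f x).toReal + ⟪Δ, z - x⟫) := by
  have hb0 : 0 < b := by rw [hb]; positivity
  have hq0 : 0 < q := hτ₀.trans_le hq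
  have h1 := hf.isProx_variational hb0 hu hz
  have h2 := hf.isProx_variational hb0 hu hx
  have ez : ⟪x - b • Δ - u, z - u⟫ = (‖u - x‖ ^ 2 + ‖u - z‖ ^ 2 - ‖x - z‖ ^ 2) / 2
      - b * (⟪Δ, z - x⟫ - ⟪Δ, u - x⟫) := by
    have a1 : x - b • Δ - u = (x - u) - b • Δ := by abel
    have a2 : z - u = (z - x) - (u - x) := by abel
    have a3 : x - z = (x - u) - (z - u) := by abel
    rw [a1, inner_sub_left, inner_smul_left, a3, norm_sub_sq_real (x - u) (z - u),
      ← inner_sub_right, ← a2, norm_sub_rev u x, norm_sub_rev u z]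
    simp only [conj_trivial]
    ring
  have ex : ⟪x - b • Δ - u, x - u⟫ = ‖u - x‖ ^ 2 + b * ⟪Δ, u - x⟫ := by
    have a1 : x - b • Δ - u = (x - u) - b • Δ := by abel
    have a2 : u - x = -(x - u) := by abel
    rw [a1, inner_sub_left, inner_smul_left, real_inner_self_eq_norm_sq, a2, inner_neg_right,
      norm_neg]
    simp only [conj_trivial]
    ring
  rw [ez] at h1
  rw [ex] at h2
  set fu := (f u).toReal
  set fx := (f x).toReal
  set fz := (f z).toReal
  set d := ‖u - x‖ ^ 2 with hd
  set e := ‖u - z‖ ^ 2 with he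
  set e' := ‖x - z‖ ^ 2 with he'
  set π := ⟪Δ, u - x⟫
  set πz := ⟪Δ, z - x⟫
  have hd0 : 0 ≤ d := sq_nonneg _
  have hbs : b * (τ * s / τ₀) = 1 := by rw [hb]; field_simp
  have A : fu + τ * s / τ₀ * ((d + e - e') / 2) + (π - πz) ≤ fz := by
    refine le_of_mul_le_mul_left ?_ hb0
    calc b * (fu + τ * s / τ₀ * ((d + e - e') / 2) + (π - πz))
        = b * fu + b * (τ * s / τ₀) * ((d + e - e') / 2) + b * (π - πz) := by ring
      _ ≤ b * fz := by rw [hbs]; linarith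
  have B : fu + τ * s / τ₀ * d + π ≤ fx := by
    refine le_of_mul_le_mul_left ?_ hb0
    calc b * (fu + τ * s / τ₀ * d + π)
        = b * fu + b * (τ * s / τ₀) * d + b * π := by ring
      _ ≤ b * fx := by rw [hbs]; linarith
  have hq1 : 0 ≤ q / τ₀ - 1 := by
    rw [sub_nonneg, le_div_iff₀ hτ₀]; linarith
  have A' := mul_le_mul_of_nonneg_left A hτ.le
  have B' := mul_le_mul_of_nonneg_left B (mul_nonneg hτ.le hq1)
  have R : 0 ≤ τ ^ 2 * s * d / (2 * τ₀) * (q / τ₀ - 1) := by positivity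
  have id : q * (τ / τ₀ * (fu - fx + π) + (τ / τ₀) ^ 2 * (s / 2) * d
      + τ ^ 2 / (2 * τ₀) * (s / q * (e - e')))
      - τ * (fz - fx + πz)
      = (τ * (fu + τ * s / τ₀ * ((d + e - e') / 2) + (π - πz)) - τ * fz)
        + (τ * (q / τ₀ - 1) * (fu + τ * s / τ₀ * d + π) - τ * (q / τ₀ - 1) * fx)
        - τ ^ 2 * s * d / (2 * τ₀) * (q / τ₀ - 1) := by
    field_simp
    ring
  linarith

theorem multiplier_estimate {Y : Type*} [NormedAddCommGroup Y] [InnerProductSpace ℝ Y] {ρ : ℝ}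
    (hρ : 0 < ρ) (t : ℝ) (yh ys u uh du : Y) :
    ⟪ys, uh + du⟫ + ρ / 2 * ‖uh + du‖ ^ 2
        + 1 / ρ * ‖yh + (ρ / 2) • (uh + du - t • u) - ys‖ ^ 2
      ≤ ⟪yh + ρ • uh, du⟫ + ρ * ‖du‖ ^ 2 + (⟪yh, uh⟫ + ρ / 2 * ‖uh‖ ^ 2
        + 1 / ρ * ‖yh - ys‖ ^ 2 - t * ⟪yh - ys, u⟫ + ρ / 2 * ‖uh - t • u‖ ^ 2) := by
  have e1 : yh + (ρ / 2) • (uh + du - t • u) - ys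
      = (yh - ys) + (ρ / 2) • (du + (uh - t • u)) := by module
  have e2 : ‖du + (uh - t • u)‖ ^ 2 ≤ 2 * ‖du‖ ^ 2 + 2 * ‖uh - t • u‖ ^ 2 := by
    have := parallelogram_law_with_norm ℝ du (uh - t • u)
    nlinarith [sq_nonneg ‖du - (uh - t • u)‖]
  have e3 : 1 / ρ * ‖(yh - ys) + (ρ / 2) • (du + (uh - t • u))‖ ^ 2
      = 1 / ρ * ‖yh - ys‖ ^ 2 + ⟪yh - ys, du + (uh - t • u)⟫
        + ρ / 4 * ‖du + (uh - t • u)‖ ^ 2 := by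
    rw [norm_add_sq_real, inner_smul_right, norm_smul, mul_pow, Real.norm_eq_abs, sq_abs]
    field_simp
    ring
  have e4 := mul_le_mul_of_nonneg_left e2 (by positivity : 0 ≤ ρ / 4)
  rw [e1, e3, norm_add_sq_real uh du]
  simp only [inner_add_left, inner_add_right, inner_sub_left, inner_sub_right, inner_smul_left,
    inner_smul_right, conj_trivial]
  nlinarith

/-! ### One iteration of the algorithm -/

section OneStep

variable {n m : ℕ} (P : Problem n m) (S : Params n m)

namespace State

variable {P}

def xh (k : ℕ) (s : State P) : BlockSpace P.p := (1 - S.τ k) • s.x + S.τ k • s.xt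

def rh (k : ℕ) (s : State P) : BlockSpace P.d := (1 - S.τ k) • s.r + S.τ k • s.rt

/-- The predicted multiplier `ŷ + ρ (K x̂ - r̂)`. -/
def ypred (k : ℕ) (s : State P) : BlockSpace P.d :=
  s.yh + S.ρ k • (P.K (s.xh S k) - s.rh S k)

def gradX (k : ℕ) (s : State P) : BlockSpace P.p := ∇ P.h (s.xh S k) + P.KT (s.ypred S k)

def gradR (k : ℕ) (s : State P) : BlockSpace P.d :=
  -s.yh + S.ρ k • (s.rh S k - P.K (s.xh S k))

/-- The proximal point of block `j` of `x̃`. -/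
def proxX (k : ℕ) (s : State P) (j : Fin n) : EuclideanSpace ℝ (Fin (P.p j)) :=
  prox (fun u => ((S.τ₀ * S.β P k / (S.τ k * S.σ j) : ℝ) : EReal) * P.f j u)
    (s.xt j - (S.τ₀ * S.β P k / (S.τ k * S.σ j)) • s.gradX S k j)

/-- The proximal point of block `i` of `r̃`. -/
def proxR (k : ℕ) (s : State P) (i : Fin m) : EuclideanSpace ℝ (Fin (P.d i)) :=
  prox (fun u => ((S.τ₀ * S.γ k / S.τ k : ℝ) : EReal) * P.g i u)
    (s.rt i - (S.τ₀ * S.γ k / S.τ k) • s.gradR S k i)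

/-- Feasibility violation `K x - r`. -/
def res (s : State P) : BlockSpace P.d := P.K s.x - s.r

end State

variable {P}

theorem step_xt (k : ℕ) (i : Fin m) (j : Fin n) (s : State P) :
    (step P S k i j s).xt = setBlock s.xt j (s.proxX S k j) := rfl

theorem step_rt (k : ℕ) (i : Fin m) (j : Fin n) (s : State P) :
    (step P S k i j s).rt = setBlock s.rt i (s.proxR S k i) := rfl

theorem step_x (k : ℕ) (i : Fin m) (j : Fin n) (s : State P) :
    (step P S k i j s).x
      = s.xh S k + (S.τ k / S.τ₀) • PiLp.single 2 j (s.proxX S k j - s.xt j) := by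
  rw [← setBlock_sub]
  rfl

theorem step_r (k : ℕ) (i : Fin m) (j : Fin n) (s : State P) :
    (step P S k i j s).r
      = s.rh S k + (S.τ k / S.τ₀) • PiLp.single 2 i (s.proxR S k i - s.rt i) := by
  rw [← setBlock_sub]
  rfl

theorem step_yh (k : ℕ) (i : Fin m) (j : Fin n) (s : State P) :
    (step P S k i j s).yh
      = s.yh + (S.ρ k / 2) • ((step P S k i j s).res - (1 - S.τ k) • s.res) := rfl

variable {S}

theorem isProx_proxX (hP : P.Assumption S.L) (hS : S.Admissible)
    (hβ : 0 < S.Lhσ ∨ 0 < S.Lbar P) (k : ℕ) (s : State P) (j : Fin n) :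
    IsProx (fun u => ((S.τ₀ * S.β P k / (S.τ k * S.σ j) : ℝ) : EReal) * P.f j u)
      (s.xt j - (S.τ₀ * S.β P k / (S.τ k * S.σ j)) • s.gradX S k j) (s.proxX S k j) := by
  have h1 := hS.τ₀_pos
  have h2 := hS.τ_pos k
  have h3 := hS.σ_pos j
  have h4 := hS.inv_β_pos hP.L_nonneg hβ k
  exact (hP.f_pcc j).isProx_prox (by rw [Params.β]; positivity) _

theorem isProx_proxR (hP : P.Assumption S.L) (hS : S.Admissible) (k : ℕ) (s : State P)
    (i : Fin m) :
    IsProx (fun u => ((S.τ₀ * S.γ k / S.τ k : ℝ) : EReal) * P.g i u)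
      (s.rt i - (S.τ₀ * S.γ k / S.τ k) • s.gradR S k i) (s.proxR S k i) := by
  have h1 := hS.τ₀_pos
  have h2 := hS.τ_pos k
  have h3 := hS.γ_pos k
  exact (hP.g_pcc i).isProx_prox (by positivity) _

theorem proxX_mem (hP : P.Assumption S.L) (hS : S.Admissible)
    (hβ : 0 < S.Lhσ ∨ 0 < S.Lbar P) (k : ℕ) (s : State P) (j : Fin n) :
    s.proxX S k j ∈ effDom (P.f j) := by
  have h1 := hS.τ₀_pos
  have h2 := hS.τ_pos k
  have h3 := hS.σ_pos j
  have h4 := hS.inv_β_pos hP.L_nonneg hβ k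
  exact (hP.f_pcc j).mem_effDom_of_isProx (by rw [Params.β]; positivity)
    (isProx_proxX hP hS hβ k s j)

theorem step_xt_mem_dom (hP : P.Assumption S.L) (hS : S.Admissible)
    (hβ : 0 < S.Lhσ ∨ 0 < S.Lbar P) (k : ℕ) (i : Fin m) (j : Fin n) {s : State P}
    (hs : s.xt ∈ P.dom) : (step P S k i j s).xt ∈ P.dom := by
  intro l
  rw [step_xt]
  by_cases hl : l = j
  · subst hl
    simpa [setBlock] using proxX_mem hP hS hβ k s l
  · simpa [setBlock, hl] using hs l

variable (S)

/-- The curvature weight `1 / β_k = L^h_σ + 4 L̄_σ ρ_k`. -/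
def curv (P : Problem n m) (k : ℕ) : ℝ := S.Lhσ + 4 * S.Lbar P * S.ρ k

/-- Contribution of updating block `j` of `x̃`. -/
def contribX (xs : BlockSpace P.p) (k : ℕ) (s : State P) (j : Fin n) : ℝ :=
  S.τ k / S.τ₀ * ((P.f j (s.proxX S k j)).toReal - (P.f j (s.xt j)).toReal
      + ⟪s.gradX S k j, s.proxX S k j - s.xt j⟫)
    + (S.τ k / S.τ₀) ^ 2 * (S.σ j * curv S P k / 2) * ‖s.proxX S k j - s.xt j‖ ^ 2
    + S.τ k ^ 2 / (2 * S.τ₀) * (S.σ j * curv S P k / S.q j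
      * (‖s.proxX S k j - xs j‖ ^ 2 - ‖s.xt j - xs j‖ ^ 2))

/-- Contribution of updating block `i` of `r̃`. -/
def contribR (xs : BlockSpace P.p) (k : ℕ) (s : State P) (i : Fin m) : ℝ :=
  S.τ k / S.τ₀ * ((P.g i (s.proxR S k i)).toReal - (P.g i (s.rt i)).toReal
      + ⟪s.gradR S k i, s.proxR S k i - s.rt i⟫)
    + (S.τ k / S.τ₀) ^ 2 * (4 * S.ρ k / 2) * ‖s.proxR S k i - s.rt i‖ ^ 2
    + S.τ k ^ 2 / (2 * S.τ₀) * (4 * S.ρ k / S.qh i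
      * (‖s.proxR S k i - P.K xs i‖ ^ 2 - ‖s.rt i - P.K xs i‖ ^ 2))

variable {S}

theorem contribX_le (hP : P.Assumption S.L) (hS : S.Admissible)
    (hβ : 0 < S.Lhσ ∨ 0 < S.Lbar P) {xs : BlockSpace P.p} (hxs : xs ∈ P.dom) (k : ℕ)
    {s : State P} (hs : s.xt ∈ P.dom) (j : Fin n) :
    S.q j * contribX S xs k s j ≤ S.τ k * ((P.f j (xs j)).toReal - (P.f j (s.xt j)).toReal
      + ⟪s.gradX S k j, xs j - s.xt j⟫) := by
  have h2 := hS.τ_pos k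
  have h3 := hS.σ_pos j
  have h4 := hS.inv_β_pos hP.L_nonneg hβ k
  refine (hP.f_pcc j).block_estimate h2 hS.τ₀_pos (S.τ₀_le_q j) (mul_pos h3 h4) ?_ (hs j)
    (hxs j) (isProx_proxX hP hS hβ k s j)
  rw [Params.β]
  field_simp

theorem contribR_le (hP : P.Assumption S.L) (hS : S.Admissible) {M : ℝ≥0}
    (hg : LipschitzExt M P.gSum) (xs : BlockSpace P.p) (k : ℕ) (s : State P) (i : Fin m) :
    S.qh i * contribR S xs k s i ≤
      S.τ k * ((P.g i (P.K xs i)).toReal - (P.g i (s.rt i)).toReal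
        + ⟪s.gradR S k i, P.K xs i - s.rt i⟫) := by
  have h2 := hS.τ_pos k
  have h3 := hS.ρ_pos k
  refine (hP.g_pcc i).block_estimate h2 hS.τ₀_pos (S.τ₀_le_qh i)
    (by positivity : 0 < 4 * S.ρ k) ?_ (hP.g_lt_top hg i _) (hP.g_lt_top hg i _)
    (isProx_proxR hP hS k s i)
  rw [Params.γ]
  field_simp

variable (S)

/-- Upper bound for `f(x^{k+1}) + g(r^{k+1})` obtained from the bound `e` for `f(x^k) + g(r^k)`. -/
def boundStep (k : ℕ) (s s' : State P) (e : ℝ) : ℝ :=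
  (1 - S.τ k) * e + S.τ k * (P.fReal s.xt + P.gReal s.rt)
    + S.τ k / S.τ₀ * (P.fReal s'.xt + P.gReal s'.rt - (P.fReal s.xt + P.gReal s.rt))

/-- The Lagrangian gap, with `e` in place of `f(x) + g(r)`. -/
def lagGap (ys : BlockSpace P.d) (s : State P) (e : ℝ) : ℝ :=
  e + P.h s.x - P.Fstar.toReal + ⟪ys, s.res⟫

/-- The weighted distance of `(x̃, r̃)` to `(x⋆, K x⋆)`. -/
def distSq (xs : BlockSpace P.p) (k : ℕ) (s : State P) : ℝ :=
  S.τ k ^ 2 / (2 * S.τ₀) * (curv S P k * wNormSq (fun j => S.σ j / S.q j) (s.xt - xs)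
    + 4 * S.ρ k * wNormSq (fun i => 1 / S.qh i) (s.rt - P.K xs))

/-- The part of the one-step bound that does not depend on the sampled indices. -/
def stepBase (xs : BlockSpace P.p) (ys : BlockSpace P.d) (k : ℕ) (s : State P) (e : ℝ) : ℝ :=
  (1 - S.τ k) * e + S.τ k * (P.fReal s.xt + P.gReal s.rt) + P.h (s.xh S k) - P.Fstar.toReal
    + (⟪s.yh, P.K (s.xh S k) - s.rh S k⟫ + S.ρ k / 2 * ‖P.K (s.xh S k) - s.rh S k‖ ^ 2
      + 1 / S.ρ k * ‖s.yh - ys‖ ^ 2 - (1 - S.τ k) * ⟪s.yh - ys, s.res⟫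
      + S.ρ k / 2 * ‖P.K (s.xh S k) - s.rh S k - (1 - S.τ k) • s.res‖ ^ 2)
    + distSq S xs k s

theorem fReal_setBlock (x : BlockSpace P.p) (j : Fin n) (u : EuclideanSpace ℝ (Fin (P.p j))) :
    P.fReal (setBlock x j u) = P.fReal x + ((P.f j u).toReal - (P.f j (x j)).toReal) :=
  sum_setBlock (fun l v => (P.f l v).toReal) x j u

theorem gReal_setBlock (r : BlockSpace P.d) (i : Fin m) (u : EuclideanSpace ℝ (Fin (P.d i))) :
    P.gReal (setBlock r i u) = P.gReal r + ((P.g i u).toReal - (P.g i (r i)).toReal) :=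
  sum_setBlock (fun l v => (P.g l v).toReal) r i u

variable {S}

theorem step_le (hP : P.Assumption S.L) (hS : S.Admissible) (xs : BlockSpace P.p)
    (ys : BlockSpace P.d) (k : ℕ) (s : State P) (e : ℝ) (i : Fin m) (j : Fin n) :
    lagGap ys (step P S k i j s) (boundStep S k s (step P S k i j s) e)
        + S.ρ k / 2 * ‖(step P S k i j s).res‖ ^ 2
        + 1 / S.ρ k * ‖(step P S k i j s).yh - ys‖ ^ 2 + distSq S xs k (step P S k i j s)
      ≤ stepBase S xs ys k s e + contribX S xs k s j + contribR S xs k s i := by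
  have hρ := hS.ρ_pos k
  have hτ := hS.τ_pos k
  have hτ₀ := hS.τ₀_pos
  set t : ℝ := S.τ k / S.τ₀ with ht
  have ht0 : 0 < t := div_pos hτ hτ₀
  set vx := s.proxX S k j - s.xt j with hvx
  set vr := s.proxR S k i - s.rt i with hvr
  set uh := P.K (s.xh S k) - s.rh S k with huh
  set dx : BlockSpace P.p := PiLp.single 2 j vx with hdx
  set dr : BlockSpace P.d := PiLp.single 2 i vr with hdr
  set du : BlockSpace P.d := t • (P.K dx - dr) with hdu
  have hres : (step P S k i j s).res = uh + du := by
    rw [State.res, step_x, step_r, map_add, map_smul, hdu, huh]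
    module
  have hh : P.h (step P S k i j s).x ≤ P.h (s.xh S k) + t * ⟪∇ P.h (s.xh S k) j, vx⟫
      + t ^ 2 * (S.Lhσ * S.σ j / 2) * ‖vx‖ ^ 2 := by
    rw [step_x, ← hdx, hdx, smul_single]
    refine (hP.h_add_single_le _ j _).trans ?_
    rw [inner_smul_right, norm_smul, mul_pow, Real.norm_eq_abs, sq_abs]
    have := mul_le_mul_of_nonneg_right (hS.L_le j) (by positivity : 0 ≤ t ^ 2 * ‖vx‖ ^ 2 / 2)
    linarith
  have hmult := multiplier_estimate hρ (1 - S.τ k) s.yh ys s.res uh du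
  have hin : ⟪s.yh + S.ρ k • uh, du⟫
      = t * (⟪P.KT (s.ypred S k) j, vx⟫ + ⟪s.gradR S k i, vr⟫) := by
    have e1 : s.yh + S.ρ k • uh = s.ypred S k := rfl
    have e2 : s.gradR S k = -s.ypred S k := by
      rw [State.gradR, State.ypred]; module
    rw [hdu, inner_smul_right, inner_sub_right, e1, ← inner_single_right (P.KT (s.ypred S k)),
      ← inner_single_right (s.gradR S k), e2, inner_neg_left, Problem.KT,
      ContinuousLinearMap.adjoint_inner_left]
    ring
  have hdu2 : ‖du‖ ^ 2 ≤ t ^ 2 * (2 * (S.Lbar P * (S.σ j * ‖vx‖ ^ 2)) + 2 * ‖vr‖ ^ 2) := by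
    rw [hdu, norm_smul, mul_pow, Real.norm_eq_abs, sq_abs]
    gcongr
    have h1 := parallelogram_law_with_norm ℝ (P.K dx) dr
    have h2 := norm_K_single_sq_le (P := P) S hS j vx
    have h3 : ‖dr‖ = ‖vr‖ := PiLp.norm_single _ _ _ _
    rw [← hdx] at h2
    rw [h3] at h1
    nlinarith [sq_nonneg ‖P.K dx + dr‖]
  have hdu3 := mul_le_mul_of_nonneg_left hdu2 hρ.le
  have hgx : ⟪s.gradX S k j, vx⟫ = ⟪∇ P.h (s.xh S k) j, vx⟫ + ⟪P.KT (s.ypred S k) j, vx⟫ := by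
    rw [State.gradX, PiLp.add_apply, inner_add_left]
  have hdist : distSq S xs k (step P S k i j s) = distSq S xs k s
      + S.τ k ^ 2 / (2 * S.τ₀) * (S.σ j * curv S P k / S.q j
        * (‖s.proxX S k j - xs j‖ ^ 2 - ‖s.xt j - xs j‖ ^ 2))
      + S.τ k ^ 2 / (2 * S.τ₀) * (4 * S.ρ k / S.qh i
        * (‖s.proxR S k i - P.K xs i‖ ^ 2 - ‖s.rt i - P.K xs i‖ ^ 2)) := by
    rw [distSq, distSq, step_xt, step_rt, wNormSq_setBlock_sub, wNormSq_setBlock_sub]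
    ring
  have hyh : (step P S k i j s).yh - ys
      = s.yh + (S.ρ k / 2) • (uh + du - (1 - S.τ k) • s.res) - ys := by
    rw [step_yh, hres]
  rw [hdist, lagGap, hyh, hres, boundStep, step_xt, step_rt, fReal_setBlock, gReal_setBlock,
    stepBase, contribX, contribR, ← huh, ← hvx, ← hvr, hgx, ← ht]
  rw [hin] at hmult
  have hcurv : t ^ 2 * (S.σ j * curv S P k / 2) * ‖vx‖ ^ 2
      = t ^ 2 * (S.Lhσ * S.σ j / 2) * ‖vx‖ ^ 2
        + S.ρ k * (t ^ 2 * (2 * (S.Lbar P * (S.σ j * ‖vx‖ ^ 2)))) := by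
    rw [curv]; ring
  linarith

theorem stepBase_add_le (hP : P.Assumption S.L) (hS : S.Admissible) {M : ℝ≥0}
    (hg : LipschitzExt M P.gSum) {xs : BlockSpace P.p} (hxs : xs ∈ P.primalSolutions)
    (hxsd : xs ∈ P.dom) (ys : BlockSpace P.d) (k : ℕ) (s : State P) (e : ℝ) :
    stepBase S xs ys k s e
        + ∑ j, S.τ k * ((P.f j (xs j)).toReal - (P.f j (s.xt j)).toReal
          + ⟪s.gradX S k j, xs j - s.xt j⟫)
        + ∑ i, S.τ k * ((P.g i (P.K xs i)).toReal - (P.g i (s.rt i)).toReal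
          + ⟪s.gradR S k i, P.K xs i - s.rt i⟫)
      ≤ (1 - S.τ k) * (lagGap ys s e + (1 - S.τ k) * (S.ρ k / 2) * ‖s.res‖ ^ 2)
        + 1 / S.ρ k * ‖s.yh - ys‖ ^ 2 + distSq S xs k s := by
  have hτ := hS.τ_pos k
  have hτ1 : S.τ k ≤ 1 := (hS.τ_le_τ₀ k).trans hS.τ₀_le_one
  have h1 : ∑ j, S.τ k * ((P.f j (xs j)).toReal - (P.f j (s.xt j)).toReal
      + ⟪s.gradX S k j, xs j - s.xt j⟫)
      = S.τ k * (P.fReal xs - P.fReal s.xt + ⟪s.gradX S k, xs - s.xt⟫) := by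
    rw [← Finset.mul_sum, Finset.sum_add_distrib, Finset.sum_sub_distrib, PiLp.inner_apply]
    rfl
  have h2 : ∑ i, S.τ k * ((P.g i (P.K xs i)).toReal - (P.g i (s.rt i)).toReal
      + ⟪s.gradR S k i, P.K xs i - s.rt i⟫)
      = S.τ k * (P.gReal (P.K xs) - P.gReal s.rt + ⟪s.gradR S k, P.K xs - s.rt⟫) := by
    rw [← Finset.mul_sum, Finset.sum_add_distrib, Finset.sum_sub_distrib, PiLp.inner_apply]
    rfl
  set uh := P.K (s.xh S k) - s.rh S k with huh
  have hx : S.τ k • (xs - s.xt) = (1 - S.τ k) • (s.x - s.xh S k) + S.τ k • (xs - s.xh S k) := by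
    rw [State.xh]; module
  have hconv : P.h (s.xh S k) + S.τ k * ⟪∇ P.h (s.xh S k), xs - s.xt⟫
      ≤ (1 - S.τ k) * P.h s.x + S.τ k * P.h xs := by
    rw [← inner_smul_right, hx, inner_add_right, inner_smul_right, inner_smul_right]
    have c1 := mul_le_mul_of_nonneg_left
      (inner_gradient_le_sub hP.h_diff hP.h_convex (s.xh S k) s.x) (sub_nonneg.2 hτ1)
    have c2 := mul_le_mul_of_nonneg_left
      (inner_gradient_le_sub hP.h_diff hP.h_convex (s.xh S k) xs) hτ.le
    linarith
  have hin : S.τ k * (⟪P.KT (s.ypred S k), xs - s.xt⟫ + ⟪s.gradR S k, P.K xs - s.rt⟫)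
      = ⟪s.yh + S.ρ k • uh, (1 - S.τ k) • s.res - uh⟫ := by
    have e2 : s.gradR S k = -s.ypred S k := by
      rw [State.gradR, State.ypred]; module
    have e3 : (1 - S.τ k) • s.res - uh
        = S.τ k • (P.K (xs - s.xt) - (P.K xs - s.rt)) := by
      rw [huh, State.res, State.xh, State.rh]
      simp only [map_add, map_smul, map_sub]
      module
    have e4 : s.yh + S.ρ k • uh = s.ypred S k := rfl
    rw [e3, e4, e2, inner_smul_right, inner_sub_right _ (P.K (xs - s.xt)), inner_neg_left,
      Problem.KT, ContinuousLinearMap.adjoint_inner_left]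
    ring
  rw [h1, h2, stepBase, ← huh, State.gradX, inner_add_left, lagGap,
    hP.Fstar_toReal_eq hg hxs hxsd]
  have hexp : ⟪s.yh + S.ρ k • uh, (1 - S.τ k) • s.res - uh⟫
      = (1 - S.τ k) * ⟪s.yh, s.res⟫ - ⟪s.yh, uh⟫ + S.ρ k * ((1 - S.τ k) * ⟪uh, s.res⟫)
        - S.ρ k * ‖uh‖ ^ 2 := by
    rw [inner_sub_right, inner_add_left, inner_add_left, inner_smul_left, inner_smul_left,
      inner_smul_right, inner_smul_right, real_inner_self_eq_norm_sq]
    simp only [conj_trivial]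
    ring
  have hnorm : ‖uh - (1 - S.τ k) • s.res‖ ^ 2
      = ‖uh‖ ^ 2 - 2 * ((1 - S.τ k) * ⟪uh, s.res⟫) + (1 - S.τ k) ^ 2 * ‖s.res‖ ^ 2 := by
    rw [norm_sub_sq_real, inner_smul_right, norm_smul, mul_pow, Real.norm_eq_abs, sq_abs]
  rw [hexp] at hin
  rw [hnorm, inner_sub_left]
  linarith

theorem sum_sum_weights (hS : S.Admissible) (B : ℝ) (a : Fin n → ℝ) (b : Fin m → ℝ) :
    ∑ i, ∑ j, S.qh i * S.q j * (B + a j + b i) = B + ∑ j, S.q j * a j + ∑ i, S.qh i * b i := by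
  have h : ∀ i, ∑ j, S.qh i * S.q j * (B + a j + b i)
      = S.qh i * (B + ∑ j, S.q j * a j) + S.qh i * b i := by
    intro i
    have : ∀ j, S.qh i * S.q j * (B + a j + b i)
        = S.q j * (S.qh i * (B + b i)) + S.qh i * (S.q j * a j) := fun j => by ring
    rw [Finset.sum_congr rfl fun j _ => this j, Finset.sum_add_distrib, ← Finset.sum_mul,
      ← Finset.mul_sum, hS.q_sum]
    ring
  rw [Finset.sum_congr rfl fun i _ => h i, Finset.sum_add_distrib, ← Finset.sum_mul, hS.qh_sum,
    one_mul]

/-- The expected decrease over one iteration. -/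
theorem expected_step_le (hP : P.Assumption S.L) (hS : S.Admissible)
    (hβ : 0 < S.Lhσ ∨ 0 < S.Lbar P) {M : ℝ≥0} (hg : LipschitzExt M P.gSum)
    {xs : BlockSpace P.p} (hxs : xs ∈ P.primalSolutions) (hxsd : xs ∈ P.dom)
    (ys : BlockSpace P.d) (k : ℕ) {s : State P} (hs : s.xt ∈ P.dom) (e : ℝ) :
    ∑ i, ∑ j, S.qh i * S.q j *
      (lagGap ys (step P S k i j s) (boundStep S k s (step P S k i j s) e)
        + S.ρ k / 2 * ‖(step P S k i j s).res‖ ^ 2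
        + 1 / S.ρ k * ‖(step P S k i j s).yh - ys‖ ^ 2 + distSq S xs k (step P S k i j s))
      ≤ (1 - S.τ k) * (lagGap ys s e + (1 - S.τ k) * (S.ρ k / 2) * ‖s.res‖ ^ 2)
        + 1 / S.ρ k * ‖s.yh - ys‖ ^ 2 + distSq S xs k s := by
  calc _ ≤ ∑ i, ∑ j, S.qh i * S.q j *
        (stepBase S xs ys k s e + contribX S xs k s j + contribR S xs k s i) := by
        refine Finset.sum_le_sum fun i _ => Finset.sum_le_sum fun j _ => ?_
        exact mul_le_mul_of_nonneg_left (step_le hP hS xs ys k s e i j)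
          (mul_nonneg (hS.qh_pos i).le (hS.q_pos j).le)
    _ = stepBase S xs ys k s e + ∑ j, S.q j * contribX S xs k s j
        + ∑ i, S.qh i * contribR S xs k s i := sum_sum_weights hS _ _ _
    _ ≤ _ := by
        refine le_trans ?_ (stepBase_add_le hP hS hg hxs hxsd ys k s e)
        exact add_le_add (add_le_add le_rfl
          (Finset.sum_le_sum fun j _ => contribX_le hP hS hβ hxsd k hs j))
          (Finset.sum_le_sum fun i _ => contribR_le hP hS hg xs k s i)

end OneStep

/-! ### The Lyapunov function along the iterates -/

section Lyapunov

variable {n m : ℕ} {P : Problem n m} (S : Params n m)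

/-- One iteration, carrying along the upper bound for `f(x) + g(r)`. -/
def augStep (k : ℕ) (i : Fin m) (j : Fin n) (a : State P × ℝ) : State P × ℝ :=
  (step P S k i j a.1, boundStep S k a.1 (step P S k i j a.1) a.2)

/-- The initial state with the value `f(x⁰) + g(K x⁰)`. -/
def augInit (x0 : BlockSpace P.p) (y0 : BlockSpace P.d) : State P × ℝ :=
  (initState P x0 y0, P.fReal x0 + P.gReal (P.K x0))

/-- The iterates together with the upper bounds for `f(x^k) + g(r^k)`. -/
def augIterate (x0 : BlockSpace P.p) (y0 : BlockSpace P.d) (is : ℕ → Fin m) (js : ℕ → Fin n)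
    (k : ℕ) : State P × ℝ :=
  orbit (augStep S) (augInit x0 y0) is js k

theorem augIterate_fst (x0 : BlockSpace P.p) (y0 : BlockSpace P.d) (is : ℕ → Fin m)
    (js : ℕ → Fin n) (k : ℕ) :
    (augIterate S x0 y0 is js k).1 = iterate P S x0 y0 is js k := by
  induction k with
  | zero => rfl
  | succ k ih =>
    rw [iterate, ← ih]
    rfl

variable {S}

theorem augIterate_xt_mem (hP : P.Assumption S.L) (hS : S.Admissible)
    (hβ : 0 < S.Lhσ ∨ 0 < S.Lbar P) {x0 : BlockSpace P.p} (hx0 : x0 ∈ P.dom)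
    (y0 : BlockSpace P.d) (is : ℕ → Fin m) (js : ℕ → Fin n) (k : ℕ) :
    (augIterate S x0 y0 is js k).1.xt ∈ P.dom := by
  induction k with
  | zero => exact hx0
  | succ k ih => exact step_xt_mem_dom hP hS hβ k (is k) (js k) ih

theorem averaging_weights_le (hS : S.Admissible) (k : ℕ) :
    S.τ (k + 1) / S.τ₀ ≤ (1 - S.τ (k + 1)) * (S.τ k / S.τ₀) + S.τ (k + 1) := by
  have h0 := hS.τ₀_pos
  have hc := hS.one_lt_c
  have h1 := hS.add_c_pos k
  have h2 := hS.add_c_pos (k + 1)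
  have e : (1 - S.τ (k + 1)) * (S.τ k / S.τ₀) + S.τ (k + 1) - S.τ (k + 1) / S.τ₀
      = S.c * (1 + S.τ₀ * k) / ((k + S.c) * ((k + 1 : ℕ) + S.c)) := by
    rw [Params.τ, Params.τ]
    push_cast at h2 ⊢
    field_simp
    ring
  have : 0 ≤ S.c * (1 + S.τ₀ * k) / ((k + S.c) * ((k + 1 : ℕ) + S.c)) := by positivity
  linarith

/-- The iterates are feasible and `f(x^k) + g(r^k)` is at most the recorded bound. -/
theorem augIterate_mem (hP : P.Assumption S.L) (hS : S.Admissible)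
    (hβ : 0 < S.Lhσ ∨ 0 < S.Lbar P) {M : ℝ≥0} (hg : LipschitzExt M P.gSum)
    {x0 : BlockSpace P.p} (hx0 : x0 ∈ P.dom) (y0 : BlockSpace P.d) (is : ℕ → Fin m)
    (js : ℕ → Fin n) (k : ℕ) :
    (augIterate S x0 y0 is js k).1.x ∈ P.dom ∧
      P.fReal (augIterate S x0 y0 is js k).1.x + P.gReal (augIterate S x0 y0 is js k).1.r
        ≤ (augIterate S x0 y0 is js k).2 := by
  set C : Set (BlockSpace P.p × BlockSpace P.d × ℝ) :=
    {v | v.1 ∈ P.dom ∧ P.fReal v.1 + P.gReal v.2.1 ≤ v.2.2} with hC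
  have hconv : Convex ℝ C := by
    rintro ⟨x, r, s⟩ ⟨hx, h1⟩ ⟨z, v, t⟩ ⟨hz, h2⟩ a b ha hb hab
    refine ⟨hP.convexOn_fReal.1 hx hz ha hb hab, ?_⟩
    have c1 := hP.convexOn_fReal.2 hx hz ha hb hab
    have c2 := (hP.convexOn_gReal hg).2 (Set.mem_univ r) (Set.mem_univ v) ha hb hab
    have m1 := mul_le_mul_of_nonneg_left h1 ha
    have m2 := mul_le_mul_of_nonneg_left h2 hb
    simp only [smul_eq_mul, Prod.smul_mk, Prod.mk_add_mk] at *
    linarith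
  set A := augIterate S x0 y0 is js with hA
  let w : ℕ → ℝ := fun k => Nat.casesOn k 1 fun l => S.τ l / S.τ₀
  have hmem := averaged_mem_of_convex hconv (τ := S.τ) (w := w)
    (fun k => (hS.τ_le_τ₀ k).trans hS.τ₀_le_one) rfl
    (fun k => by
      cases k with
      | zero => exact zero_le_one
      | succ k => exact (div_pos (hS.τ_pos k) hS.τ₀_pos).le)
    (fun k => by
      cases k with
      | zero => exact le_rfl
      | succ k => exact (div_le_one hS.τ₀_pos).2 (hS.τ_le_τ₀ k))
    (fun k => by
      cases k with
      | zero =>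
        show S.τ 0 / S.τ₀ ≤ (1 - S.τ 0) * 1 + S.τ 0
        have := (div_le_one hS.τ₀_pos).2 (hS.τ_le_τ₀ 0)
        linarith
      | succ k => exact averaging_weights_le hS k)
    (X := fun k => ((A k).1.x, (A k).1.r, (A k).2))
    (Z := fun k => ((A k).1.xt, (A k).1.rt, P.fReal (A k).1.xt + P.gReal (A k).1.rt))
    (fun k => ⟨augIterate_xt_mem hP hS hβ hx0 y0 is js k, le_rfl⟩) rfl
    (fun k => by
      refine Prod.ext rfl (Prod.ext rfl ?_)
      rfl) k
  exact hmem

theorem lagGap_nonneg {ys : BlockSpace P.d} (hys : P.IsMultiplier ys) {s : State P} {e : ℝ}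
    (hs : s.x ∈ P.dom) (he : P.fReal s.x + P.gReal s.r ≤ e) : 0 ≤ lagGap ys s e := by
  have := hys s.x hs s.r
  rw [lagGap, State.res]
  linarith

theorem objective_sub_le (hP : P.Assumption S.L) {M : ℝ≥0} (hg : LipschitzExt M P.gSum)
    (ys : BlockSpace P.d) {s : State P} {e : ℝ} (hs : s.x ∈ P.dom)
    (he : P.fReal s.x + P.gReal s.r ≤ e) :
    (P.F s.x).toReal - P.Fstar.toReal ≤ lagGap ys s e + (M + ‖ys‖) * ‖s.res‖ := by
  rw [hP.F_eq hg hs, EReal.toReal_coe, lagGap]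
  have h1 : P.gReal (P.K s.x) ≤ P.gReal s.r + M * ‖s.res‖ := hP.gReal_le hg _ _
  have h2 := neg_le_of_abs_le (abs_real_inner_le_norm ys s.res)
  linarith

variable (S)

/-- The Lyapunov function. -/
def lyapunov (xs : BlockSpace P.p) (ys : BlockSpace P.d) (k : ℕ) (a : State P × ℝ) : ℝ :=
  (k + S.c - 1) / (S.c * S.τ₀) * lagGap ys a.1 a.2
    + (k + S.c - 1) ^ 2 * S.ρ₀ / (2 * S.c ^ 2 * S.τ₀) * ‖a.1.res‖ ^ 2
    + 1 / (S.ρ₀ * S.τ₀) * ‖a.1.yh - ys‖ ^ 2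
    + ((S.τ k * S.Lhσ + 4 * S.Lbar P * S.ρ₀ * S.τ₀) / (2 * S.τ₀)
        * wNormSq (fun j => S.σ j / S.q j) (a.1.xt - xs)
      + 2 * S.ρ₀ * wNormSq (fun i => 1 / S.qh i) (a.1.rt - P.K xs))

variable {S}

theorem τ_succ_le (hS : S.Admissible) (k : ℕ) : S.τ (k + 1) ≤ S.τ k := by
  have h1 := hS.add_c_pos k
  have h2 : 0 ≤ S.c * S.τ₀ := mul_nonneg (by linarith [hS.one_lt_c]) hS.τ₀_pos.le
  rw [Params.τ, Params.τ]
  push_cast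
  gcongr
  linarith

theorem distSq_div_τ (hS : S.Admissible) (xs : BlockSpace P.p) (k : ℕ) (s : State P) :
    1 / S.τ k * distSq S xs k s = (S.τ k * S.Lhσ + 4 * S.Lbar P * S.ρ₀ * S.τ₀) / (2 * S.τ₀)
        * wNormSq (fun j => S.σ j / S.q j) (s.xt - xs)
      + 2 * S.ρ₀ * wNormSq (fun i => 1 / S.qh i) (s.rt - P.K xs) := by
  have h1 := (hS.τ_pos k).ne'
  have h2 := hS.τ₀_pos.ne'
  rw [distSq, curv, Params.ρ]
  field_simp
  ring

theorem le_lyapunov (hS : S.Admissible) (hL : ∀ j, 0 ≤ S.L j) (xs : BlockSpace P.p)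
    (ys : BlockSpace P.d) (k : ℕ) (a : State P × ℝ) :
    (k + S.c - 1) / (S.c * S.τ₀) * lagGap ys a.1 a.2
      + (k + S.c - 1) ^ 2 * S.ρ₀ / (2 * S.c ^ 2 * S.τ₀) * ‖a.1.res‖ ^ 2 ≤ lyapunov S xs ys k a := by
  have h0 := hS.τ₀_pos
  have h1 := hS.τ_pos k
  have h2 := hS.ρ₀_pos
  have h3 := hS.Lhσ_nonneg hL
  have h4 := S.Lbar_nonneg P
  have w1 : 0 ≤ wNormSq (fun j => S.σ j / S.q j) (a.1.xt - xs) :=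
    wNormSq_nonneg (fun j => (div_pos (hS.σ_pos j) (hS.q_pos j)).le) _
  have w2 : 0 ≤ wNormSq (fun i => 1 / S.qh i) (a.1.rt - P.K xs) :=
    wNormSq_nonneg (fun i => (div_pos one_pos (hS.qh_pos i)).le) _
  have h5 : 0 ≤ 1 / (S.ρ₀ * S.τ₀) * ‖a.1.yh - ys‖ ^ 2 := by positivity
  have h6 : 0 ≤ (S.τ k * S.Lhσ + 4 * S.Lbar P * S.ρ₀ * S.τ₀) / (2 * S.τ₀)
        * wNormSq (fun j => S.σ j / S.q j) (a.1.xt - xs)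
      + 2 * S.ρ₀ * wNormSq (fun i => 1 / S.qh i) (a.1.rt - P.K xs) := by positivity
  rw [lyapunov]
  linarith

theorem lyapunov_succ_le (hS : S.Admissible) (hL : ∀ j, 0 ≤ S.L j) (xs : BlockSpace P.p)
    (ys : BlockSpace P.d) (k : ℕ) (a : State P × ℝ) :
    lyapunov S xs ys (k + 1) a ≤ 1 / S.τ k * (lagGap ys a.1 a.2
      + S.ρ k / 2 * ‖a.1.res‖ ^ 2 + 1 / S.ρ k * ‖a.1.yh - ys‖ ^ 2 + distSq S xs k a.1) := by
  have h0 := hS.τ₀_pos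
  have h1 := hS.τ_pos k
  have h2 := hS.ρ₀_pos
  have h3 := hS.Lhσ_nonneg hL
  have hc := hS.one_lt_c
  have hk := hS.add_c_pos k
  have hc0 : 0 < S.c := by linarith
  have e1 : (((k + 1 : ℕ) : ℝ) + S.c - 1) / (S.c * S.τ₀) = 1 / S.τ k := by
    rw [Params.τ]
    push_cast
    field_simp
    ring
  have e2 : (((k + 1 : ℕ) : ℝ) + S.c - 1) ^ 2 * S.ρ₀ / (2 * S.c ^ 2 * S.τ₀)
      = 1 / S.τ k * (S.ρ k / 2) := by
    rw [Params.ρ, Params.τ]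
    push_cast
    field_simp
    ring
  have e3 : 1 / (S.ρ₀ * S.τ₀) = 1 / S.τ k * (1 / S.ρ k) := by
    rw [Params.ρ]
    field_simp
  have w1 : 0 ≤ wNormSq (fun j => S.σ j / S.q j) (a.1.xt - xs) :=
    wNormSq_nonneg (fun j => (div_pos (hS.σ_pos j) (hS.q_pos j)).le) _
  have h4 : (S.τ (k + 1) * S.Lhσ + 4 * S.Lbar P * S.ρ₀ * S.τ₀) / (2 * S.τ₀)
        * wNormSq (fun j => S.σ j / S.q j) (a.1.xt - xs)
      ≤ (S.τ k * S.Lhσ + 4 * S.Lbar P * S.ρ₀ * S.τ₀) / (2 * S.τ₀)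
        * wNormSq (fun j => S.σ j / S.q j) (a.1.xt - xs) := by
    have := τ_succ_le hS k
    gcongr
  rw [lyapunov, e1, e2, e3, mul_add, mul_add, mul_add, distSq_div_τ hS]
  linarith

/-- The guaranteed decrease of the Lyapunov function. -/
theorem expected_lyapunov_le (hP : P.Assumption S.L) (hS : S.Admissible)
    (hβ : 0 < S.Lhσ ∨ 0 < S.Lbar P) (hc : 1 < S.c * S.τ₀) {M : ℝ≥0}
    (hg : LipschitzExt M P.gSum) {xs : BlockSpace P.p} (hxs : xs ∈ P.primalSolutions)
    (hxsd : xs ∈ P.dom) (ys : BlockSpace P.d) (k : ℕ) {a : State P × ℝ}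
    (ha : a.1.xt ∈ P.dom) :
    ∑ i, ∑ j, S.qh i * S.q j * lyapunov S xs ys (k + 1) (augStep S k i j a)
      ≤ lyapunov S xs ys k a - ((S.c * S.τ₀ - 1) / (S.c * S.τ₀) * lagGap ys a.1 a.2
        + (S.c * S.τ₀ - 1) * S.ρ₀ / (2 * S.c ^ 2 * S.τ₀) * (k * ‖a.1.res‖ ^ 2)) := by
  have h0 := hS.τ₀_pos
  have h1 := hS.τ_pos k
  have h2 := hS.ρ₀_pos
  have hc1 := hS.one_lt_c
  have hc0 : 0 < S.c := by linarith
  have hk := hS.add_c_pos k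
  have hstep := mul_le_mul_of_nonneg_left
    (expected_step_le hP hS hβ hg hxs hxsd ys k ha a.2) (one_div_pos.2 h1).le
  calc ∑ i, ∑ j, S.qh i * S.q j * lyapunov S xs ys (k + 1) (augStep S k i j a)
      ≤ ∑ i, ∑ j, S.qh i * S.q j * (1 / S.τ k * _) :=
        Finset.sum_le_sum fun i _ => Finset.sum_le_sum fun j _ =>
          mul_le_mul_of_nonneg_left (lyapunov_succ_le hS hP.L_nonneg xs ys k (augStep S k i j a))
            (mul_nonneg (hS.qh_pos i).le (hS.q_pos j).le)
    _ = 1 / S.τ k * ∑ i, ∑ j, S.qh i * S.q j * _ := by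
        simp only [Finset.mul_sum]
        exact Finset.sum_congr rfl fun i _ => Finset.sum_congr rfl fun j _ => mul_left_comm _ _ _
    _ ≤ _ := hstep
    _ ≤ _ := by
        have e1 : 1 / S.τ k * (1 - S.τ k) = (k + S.c - S.c * S.τ₀) / (S.c * S.τ₀) := by
          rw [Params.τ]
          field_simp
        have e2 : 1 / S.τ k * (1 - S.τ k) * ((1 - S.τ k) * (S.ρ k / 2))
            = (k + S.c - S.c * S.τ₀) ^ 2 * S.ρ₀ / (2 * S.c ^ 2 * S.τ₀) := by
          rw [Params.ρ, Params.τ]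
          field_simp
        have e3 : 1 / S.τ k * (1 / S.ρ k) = 1 / (S.ρ₀ * S.τ₀) := by
          rw [Params.ρ]
          field_simp
        have e4 : 1 / S.τ k * ((1 - S.τ k) * (lagGap ys a.1 a.2
              + (1 - S.τ k) * (S.ρ k / 2) * ‖a.1.res‖ ^ 2)
              + 1 / S.ρ k * ‖a.1.yh - ys‖ ^ 2 + distSq S xs k a.1)
            = 1 / S.τ k * (1 - S.τ k) * lagGap ys a.1 a.2
              + 1 / S.τ k * (1 - S.τ k) * ((1 - S.τ k) * (S.ρ k / 2)) * ‖a.1.res‖ ^ 2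
              + 1 / S.τ k * (1 / S.ρ k) * ‖a.1.yh - ys‖ ^ 2 + 1 / S.τ k * distSq S xs k a.1 := by
          ring
        rw [e4, e2, e1, e3, distSq_div_τ hS, lyapunov]
        have e5 : (k + S.c - 1) / (S.c * S.τ₀) - (S.c * S.τ₀ - 1) / (S.c * S.τ₀)
            = (k + S.c - S.c * S.τ₀) / (S.c * S.τ₀) := by
          rw [← sub_div]
          ring
        have h5 : (k + S.c - S.c * S.τ₀) ^ 2 * S.ρ₀ / (2 * S.c ^ 2 * S.τ₀)
            + (S.c * S.τ₀ - 1) * S.ρ₀ / (2 * S.c ^ 2 * S.τ₀) * k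
            ≤ (k + S.c - 1) ^ 2 * S.ρ₀ / (2 * S.c ^ 2 * S.τ₀) := by
          rw [div_mul_eq_mul_div, ← add_div]
          refine div_le_div_of_nonneg_right ?_ (by positivity)
          have hτ1 : S.c * S.τ₀ ≤ S.c := mul_le_of_le_one_right hc0.le hS.τ₀_le_one
          have hk0 : (0 : ℝ) ≤ k := by positivity
          have : (k + S.c - S.c * S.τ₀) ^ 2 + (S.c * S.τ₀ - 1) * k ≤ (k + S.c - 1) ^ 2 := by
            nlinarith
          nlinarith
        have h6 := mul_le_mul_of_nonneg_right h5 (sq_nonneg ‖a.1.res‖)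
        rw [← e5]
        linarith

theorem lyapunov_zero_le (hP : P.Assumption S.L) (hS : S.Admissible) {M : ℝ≥0}
    (hg : LipschitzExt M P.gSum) {x0 : BlockSpace P.p} (hx0 : x0 ∈ P.dom) (y0 : BlockSpace P.d)
    {xs : BlockSpace P.p} (hxs : xs ∈ P.primalSolutions) (hxsd : xs ∈ P.dom)
    (ys : BlockSpace P.d) :
    lyapunov S xs ys 0 (augInit x0 y0) ≤ E0sq P S x0 y0 xs ys / S.τ₀ := by
  have h0 := hS.τ₀_pos
  have h2 := hS.ρ₀_pos
  have hc1 := hS.one_lt_c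
  have hc0 : 0 < S.c := by linarith
  have hτ : S.τ 0 = S.τ₀ := by
    rw [Params.τ]
    push_cast
    field_simp
    ring
  have hF : (P.F x0 - P.Fstar).toReal
      = P.fReal x0 + P.h x0 + P.gReal (P.K x0) - P.Fstar.toReal := by
    rw [Problem.Fstar_eq hxs, hP.F_eq hg hx0, hP.F_eq hg hxsd, ← EReal.coe_sub, EReal.toReal_coe,
      EReal.toReal_coe]
  have hgap : 0 ≤ P.fReal x0 + P.h x0 + P.gReal (P.K x0) - P.Fstar.toReal :=
    sub_nonneg.2 (hP.Fstar_toReal_le hg hxs hxsd hx0)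
  have hres : (augInit x0 y0 : State P × ℝ).1.res = 0 := sub_self _
  have hlag : lagGap ys (augInit x0 y0 : State P × ℝ).1 (augInit x0 y0 : State P × ℝ).2
      = P.fReal x0 + P.h x0 + P.gReal (P.K x0) - P.Fstar.toReal := by
    rw [lagGap, hres, inner_zero_right]
    simp only [augInit, initState]
    ring
  rw [lyapunov, hlag, hres, hτ, E0sq, hF, map_sub]
  simp only [augInit, initState]
  set D := P.fReal x0 + P.h x0 + P.gReal (P.K x0) - P.Fstar.toReal
  set W := wNormSq (fun j => S.σ j / S.q j) (x0 - xs)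
  set W' := wNormSq (fun i => 1 / S.qh i) (P.K x0 - P.K xs)
  have h5 : (((0 : ℕ) : ℝ) + S.c - 1) / (S.c * S.τ₀) * D ≤ 1 / S.τ₀ * D := by
    refine mul_le_mul_of_nonneg_right ?_ hgap
    rw [div_le_div_iff₀ (by positivity) h0]
    push_cast
    nlinarith
  have e : (D + 1 / S.ρ₀ * ‖y0 - ys‖ ^ 2 + (S.Lhσ + 4 * S.ρ₀ * S.Lbar P) * S.τ₀ / 2 * W
      + 2 * S.τ₀ * S.ρ₀ * W') / S.τ₀ = 1 / S.τ₀ * D + 1 / (S.ρ₀ * S.τ₀) * ‖y0 - ys‖ ^ 2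
      + ((S.τ₀ * S.Lhσ + 4 * S.Lbar P * S.ρ₀ * S.τ₀) / (2 * S.τ₀) * W + 2 * S.ρ₀ * W') := by
    field_simp
    ring
  rw [e, norm_zero]
  linarith

end Lyapunov

/-! ### Expectations of the iterates -/

section Expectation

variable {n m : ℕ} {P : Problem n m} {S : Params n m} {M : ℝ≥0} {x0 xs : BlockSpace P.p}
  {y0 ys : BlockSpace P.d} {Ω : Type*} [MeasurableSpace Ω] {μ : Measure Ω}
  [IsProbabilityMeasure μ] {is : ℕ → Ω → Fin m} {js : ℕ → Ω → Fin n}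

theorem integrable_augIterate (hsamp : Sampling S μ is js) (Φ : State P × ℝ → ℝ) (k : ℕ) :
    Integrable (fun ω => Φ (augIterate S x0 y0 (fun l => is l ω) (fun l => js l ω) k)) μ :=
  integrable_orbit hsamp (augStep S) (augInit x0 y0) Φ k

theorem integral_lyapunov_succ_le (hP : P.Assumption S.L) (hS : S.Admissible)
    (hβ : 0 < S.Lhσ ∨ 0 < S.Lbar P) (hc : 1 < S.c * S.τ₀) (hg : LipschitzExt M P.gSum)
    (hx0 : x0 ∈ P.dom) (hsamp : Sampling S μ is js) (hxs : xs ∈ P.primalSolutions)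
    (hxsd : xs ∈ P.dom) (k : ℕ) :
    ∫ ω, lyapunov S xs ys (k + 1)
        (augIterate S x0 y0 (fun l => is l ω) (fun l => js l ω) (k + 1)) ∂μ
      ≤ ∫ ω, lyapunov S xs ys k
          (augIterate S x0 y0 (fun l => is l ω) (fun l => js l ω) k) ∂μ
        - ((S.c * S.τ₀ - 1) / (S.c * S.τ₀) *
            ∫ ω, lagGap ys (augIterate S x0 y0 (fun l => is l ω) (fun l => js l ω) k).1
              (augIterate S x0 y0 (fun l => is l ω) (fun l => js l ω) k).2 ∂μ
          + (S.c * S.τ₀ - 1) * S.ρ₀ / (2 * S.c ^ 2 * S.τ₀) * (k *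
            ∫ ω, ‖(augIterate S x0 y0 (fun l => is l ω) (fun l => js l ω) k).1.res‖ ^ 2 ∂μ)) := by
  have hI := fun Φ => integrable_augIterate (x0 := x0) (y0 := y0) hsamp Φ k
  have i1 := hI (lyapunov S xs ys k)
  have i2 := hI fun a => lagGap ys a.1 a.2
  have i3 := hI fun a => ‖a.1.res‖ ^ 2
  have i4 := hI fun a => (S.c * S.τ₀ - 1) / (S.c * S.τ₀) * lagGap ys a.1 a.2
    + (S.c * S.τ₀ - 1) * S.ρ₀ / (2 * S.c ^ 2 * S.τ₀) * (k * ‖a.1.res‖ ^ 2)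
  rw [← integral_const_mul, ← integral_const_mul, ← integral_const_mul,
    ← integral_add (i2.const_mul _) ((i3.const_mul _).const_mul _),
    ← integral_sub i1 i4]
  refine (integral_orbit_succ hsamp (augStep S) (augInit x0 y0) _ k).trans_le ?_
  refine integral_mono (hI fun a => ∑ i, ∑ j, S.qh i * S.q j *
      lyapunov S xs ys (k + 1) (augStep S k i j a))
    (i1.sub i4) fun ω => ?_
  exact expected_lyapunov_le hP hS hβ hc hg hxs hxsd ys k
    (augIterate_xt_mem hP hS hβ hx0 y0 _ _ k)

theorem integral_lyapunov_le (hP : P.Assumption S.L) (hS : S.Admissible)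
    (hβ : 0 < S.Lhσ ∨ 0 < S.Lbar P) (hc : 1 < S.c * S.τ₀) (hg : LipschitzExt M P.gSum)
    (hx0 : x0 ∈ P.dom) (hsamp : Sampling S μ is js) (hxs : xs ∈ P.primalSolutions)
    (hxsd : xs ∈ P.dom) (k : ℕ) :
    ∫ ω, lyapunov S xs ys k
        (augIterate S x0 y0 (fun l => is l ω) (fun l => js l ω) k) ∂μ
      + ∑ l ∈ Finset.range k, ((S.c * S.τ₀ - 1) / (S.c * S.τ₀) *
          ∫ ω, lagGap ys (augIterate S x0 y0 (fun l => is l ω) (fun l => js l ω) l).1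
            (augIterate S x0 y0 (fun l => is l ω) (fun l => js l ω) l).2 ∂μ
        + (S.c * S.τ₀ - 1) * S.ρ₀ / (2 * S.c ^ 2 * S.τ₀) * (l *
          ∫ ω, ‖(augIterate S x0 y0 (fun l => is l ω) (fun l => js l ω) l).1.res‖ ^ 2 ∂μ))
      ≤ E0sq P S x0 y0 xs ys / S.τ₀ := by
  induction k with
  | zero =>
    simp only [augIterate, orbit, Finset.range_zero, Finset.sum_empty, add_zero,
      integral_const, probReal_univ, one_smul]
    exact lyapunov_zero_le hP hS hg hx0 y0 hxs hxsd ys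
  | succ k ih =>
    rw [Finset.sum_range_succ]
    have := integral_lyapunov_succ_le (y0 := y0) (ys := ys) hP hS hβ hc hg hx0 hsamp hxs hxsd k
    linarith

theorem sq_integral_le_integral_sq {f : Ω → ℝ} (hf : Integrable f μ)
    (hf2 : Integrable (fun ω => f ω ^ 2) μ) : (∫ ω, f ω ∂μ) ^ 2 ≤ ∫ ω, f ω ^ 2 ∂μ := by
  set a := ∫ ω, f ω ∂μ with ha
  have h : 0 ≤ ∫ ω, (f ω - a) ^ 2 ∂μ := integral_nonneg fun ω => sq_nonneg _
  have e : ∫ ω, (f ω - a) ^ 2 ∂μ = ∫ ω, f ω ^ 2 ∂μ - 2 * a * a + a ^ 2 := by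
    have : ∀ ω, (f ω - a) ^ 2 = f ω ^ 2 - 2 * a * f ω + a ^ 2 := fun ω => by ring
    have hi : Integrable (fun ω => f ω ^ 2 - 2 * a * f ω) μ := hf2.sub (hf.const_mul _)
    simp only [this]
    rw [integral_add hi (integrable_const _),
      integral_sub hf2 (hf.const_mul _), integral_const_mul, integral_const, probReal_univ,
      one_smul]
  linarith [e ▸ h]

/-- Expected Lagrangian gap and feasibility violation: rates, and summability. -/
theorem expected_gap_and_residual (hP : P.Assumption S.L) (hS : S.Admissible)
    (hβ : 0 < S.Lhσ ∨ 0 < S.Lbar P) (hc : 1 < S.c * S.τ₀) (hg : LipschitzExt M P.gSum)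
    (hx0 : x0 ∈ P.dom) (hsamp : Sampling S μ is js) (hxs : xs ∈ P.primalSolutions)
    (hxsd : xs ∈ P.dom) (hys : P.IsMultiplier ys) :
    ∃ A U : ℕ → ℝ, (∀ k, 0 ≤ A k) ∧
      (∀ k, ∫ ω, ((P.F (augIterate S x0 y0 (fun l => is l ω) (fun l => js l ω) k).1.x).toReal
        - P.Fstar.toReal) ∂μ ≤ A k + (M + ‖ys‖) * U k) ∧
      (∀ k : ℕ, (k + S.c - 1) * A k ≤ S.c * E0sq P S x0 y0 xs ys) ∧
      (∀ k : ℕ, ((k + S.c - 1) * U k) ^ 2 ≤ 2 * S.c ^ 2 / S.ρ₀ * E0sq P S x0 y0 xs ys) ∧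
      Summable A ∧ Summable fun k : ℕ => k * U k ^ 2 := by
  set orb : ℕ → Ω → State P × ℝ :=
    fun k ω => augIterate S x0 y0 (fun l => is l ω) (fun l => js l ω) k with horb
  have hI : ∀ k (Φ : State P × ℝ → ℝ), Integrable (fun ω => Φ (orb k ω)) μ :=
    fun k Φ => integrable_augIterate hsamp Φ k
  have h0 := hS.τ₀_pos
  have hρ := hS.ρ₀_pos
  have hc1 := hS.one_lt_c
  have hc0 : 0 < S.c := by linarith
  have hkc : ∀ k : ℕ, 0 < (k : ℝ) + S.c - 1 := fun k => by
    have : (0 : ℝ) ≤ k := by positivity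
    linarith
  have hmem := fun k ω => augIterate_mem hP hS hβ hg hx0 y0 (fun l => is l ω) (fun l => js l ω) k
  have hgap : ∀ k ω, 0 ≤ lagGap ys (orb k ω).1 (orb k ω).2 :=
    fun k ω => lagGap_nonneg hys (hmem k ω).1 (hmem k ω).2
  set A : ℕ → ℝ := fun k => ∫ ω, lagGap ys (orb k ω).1 (orb k ω).2 ∂μ with hA
  set B : ℕ → ℝ := fun k => ∫ ω, ‖(orb k ω).1.res‖ ^ 2 ∂μ with hB
  set U : ℕ → ℝ := fun k => ∫ ω, ‖(orb k ω).1.res‖ ∂μ with hU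
  have hA0 : ∀ k, 0 ≤ A k := fun k => integral_nonneg (hgap k)
  have hB0 : ∀ k, 0 ≤ B k := fun k => integral_nonneg fun ω => sq_nonneg _
  have hUB : ∀ k, U k ^ 2 ≤ B k := fun k =>
    sq_integral_le_integral_sq (hI k fun a => ‖a.1.res‖) (hI k fun a => ‖a.1.res‖ ^ 2)
  have hlyap : ∀ k, ∫ ω, lyapunov S xs ys k (orb k ω) ∂μ
      + ∑ l ∈ Finset.range k, ((S.c * S.τ₀ - 1) / (S.c * S.τ₀) * A l
        + (S.c * S.τ₀ - 1) * S.ρ₀ / (2 * S.c ^ 2 * S.τ₀) * (l * B l))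
      ≤ E0sq P S x0 y0 xs ys / S.τ₀ :=
    integral_lyapunov_le hP hS hβ hc hg hx0 hsamp hxs hxsd
  have hlow : ∀ k : ℕ, (k + S.c - 1) / (S.c * S.τ₀) * A k
      + (k + S.c - 1) ^ 2 * S.ρ₀ / (2 * S.c ^ 2 * S.τ₀) * B k
      ≤ ∫ ω, lyapunov S xs ys k (orb k ω) ∂μ := by
    intro k
    have i1 := hI k fun a => lagGap ys a.1 a.2
    have i2 := hI k fun a => ‖a.1.res‖ ^ 2
    rw [hA, hB]
    simp only
    rw [← integral_const_mul, ← integral_const_mul,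
      ← integral_add (i1.const_mul _) (i2.const_mul _)]
    exact integral_mono ((i1.const_mul _).add (i2.const_mul _)) (hI k _)
      fun ω => le_lyapunov hS hP.L_nonneg xs ys k (orb k ω)
  set κ₁ := (S.c * S.τ₀ - 1) / (S.c * S.τ₀) with hκ₁
  set κ₂ := (S.c * S.τ₀ - 1) * S.ρ₀ / (2 * S.c ^ 2 * S.τ₀) with hκ₂
  have hcτ : 0 < S.c * S.τ₀ - 1 := by linarith
  have hκ₁0 : 0 < κ₁ := by positivity
  have hκ₂0 : 0 < κ₂ := by positivity
  have hterm : ∀ l : ℕ, 0 ≤ κ₁ * A l ∧ 0 ≤ κ₂ * (l * B l) := fun l =>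
    ⟨mul_nonneg hκ₁0.le (hA0 l), mul_nonneg hκ₂0.le (mul_nonneg (by positivity) (hB0 l))⟩
  have hsum0 : ∀ k, 0 ≤ ∑ l ∈ Finset.range k, (κ₁ * A l + κ₂ * (l * B l)) := fun k =>
    Finset.sum_nonneg fun l _ => add_nonneg (hterm l).1 (hterm l).2
  have p1 : ∀ k : ℕ, 0 ≤ (k + S.c - 1) / (S.c * S.τ₀) * A k := fun k =>
    mul_nonneg (div_nonneg (hkc k).le (by positivity)) (hA0 k)
  have p2 : ∀ k : ℕ, 0 ≤ (k + S.c - 1) ^ 2 * S.ρ₀ / (2 * S.c ^ 2 * S.τ₀) * B k := fun k =>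
    mul_nonneg (by positivity) (hB0 k)
  have hs : Summable fun l : ℕ => κ₁ * A l + κ₂ * (l * B l) :=
    summable_of_sum_range_le (fun l => add_nonneg (hterm l).1 (hterm l).2)
      (c := E0sq P S x0 y0 xs ys / S.τ₀) fun k => by
        linarith [hlyap k, hlow k, p1 k, p2 k]
  refine ⟨A, U, hA0, fun k => ?_, fun k => ?_, fun k => ?_, ?_, ?_⟩
  · have i1 := hI k fun a => lagGap ys a.1 a.2
    have i2 := hI k fun a => ‖a.1.res‖
    rw [hA, hU]
    simp only
    rw [← integral_const_mul, ← integral_add i1 (i2.const_mul _)]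
    exact integral_mono (hI k fun a => (P.F a.1.x).toReal - P.Fstar.toReal)
      (i1.add (i2.const_mul _)) fun ω => objective_sub_le hP hg ys (hmem k ω).1 (hmem k ω).2
  · have h := hlyap k
    have h' : (k + S.c - 1) / (S.c * S.τ₀) * A k ≤ E0sq P S x0 y0 xs ys / S.τ₀ := by
      linarith [hlow k, p2 k, hsum0 k]
    rw [div_mul_eq_mul_div, div_le_div_iff₀ (by positivity) h0] at h'
    refine le_of_mul_le_mul_right ?_ h0
    linarith
  · have h := hlyap k
    have h' : (k + S.c - 1) ^ 2 * S.ρ₀ / (2 * S.c ^ 2 * S.τ₀) * B k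
        ≤ E0sq P S x0 y0 xs ys / S.τ₀ := by
      linarith [hlow k, p1 k, hsum0 k]
    rw [div_mul_eq_mul_div, div_le_div_iff₀ (by positivity) h0] at h'
    have h2 : (k + S.c - 1) ^ 2 * S.ρ₀ * B k ≤ 2 * S.c ^ 2 * E0sq P S x0 y0 xs ys := by
      refine le_of_mul_le_mul_right ?_ h0
      linarith
    rw [mul_pow, div_mul_eq_mul_div, le_div_iff₀ hρ]
    have h3 := mul_le_mul_of_nonneg_left (hUB k)
      (by positivity : 0 ≤ ((k : ℝ) + S.c - 1) ^ 2 * S.ρ₀)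
    linarith
  · refine (summable_mul_left_iff hκ₁0.ne').1
      (hs.of_nonneg_of_le (fun l => (hterm l).1) fun l => ?_)
    linarith [(hterm l).2]
  · refine Summable.of_nonneg_of_le (fun l => by positivity) (fun l => ?_)
      ((summable_mul_left_iff hκ₂0.ne').1
        (hs.of_nonneg_of_le (fun l => (hterm l).2) fun l => by linarith [(hterm l).1]))
    exact mul_le_mul_of_nonneg_left (hUB l) (by positivity)

/-- A nonnegative real sequence that is frequently small has vanishing lower limit. -/
theorem liminf_coe_eq_zero {u : ℕ → ℝ} (h0 : ∀ k, 0 ≤ u k)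
    (h : ∀ ε : ℝ, 0 < ε → ∃ᶠ k in atTop, u k < ε) :
    liminf (fun k => ((u k : ℝ) : EReal)) atTop = 0 := by
  refine le_antisymm ?_ (le_liminf_of_le (by isBoundedDefault)
    (Eventually.of_forall fun k => by exact_mod_cast h0 k))
  by_contra hcon
  obtain ⟨ε, h1, h2⟩ := EReal.lt_iff_exists_real_btwn.1 (not_le.1 hcon)
  have hε : 0 < ε := by exact_mod_cast h1
  have hev := eventually_lt_of_lt_liminf h2
  obtain ⟨k, hk1, hk2⟩ := ((h ε hε).and_eventually hev).exists
  have : ε < u k := by exact_mod_cast hk2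
  linarith

end Expectation

end RandomizedPD

end

theorem theorem3p2 {n m : ℕ} (P : RandomizedPD.Problem n m) (S : RandomizedPD.Params n m)
    (hP : P.Assumption S.L) (hS : S.Admissible)
    -- the step size `β_k` is well defined
    (hβ : 0 < S.Lhσ ∨ 0 < S.Lbar P)
    (hc : 1 < S.c * S.τ₀)
    (M : ℝ≥0) (hg : RandomizedPD.LipschitzExt M P.gSum)
    (x0 : RandomizedPD.BlockSpace P.p) (y0 : RandomizedPD.BlockSpace P.d) (hx0 : P.F x0 < ⊤)
    {Ω : Type*} [MeasurableSpace Ω] (μ : Measure Ω) [IsProbabilityMeasure μ]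
    (is : ℕ → Ω → Fin m) (js : ℕ → Ω → Fin n) (hsamp : RandomizedPD.Sampling S μ is js)
    (x : ℕ → Ω → RandomizedPD.BlockSpace P.p)
    (hx : ∀ k ω, x k ω =
      (RandomizedPD.iterate P S x0 y0 (fun l => is l ω) (fun l => js l ω) k).x) :
    -- the expectations below are expectations of finite, integrable random variables
    (∀ k, (∀ᵐ ω ∂μ, P.F (x k ω) < ⊤) ∧ Integrable (fun ω => (P.F (x k ω)).toReal) μ) ∧
    (∀ xs ∈ P.primalSolutions, ∀ ys ∈ P.dualSolutions, ∀ k : ℕ,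
      ∫ ω, ((P.F (x k ω)).toReal - P.Fstar.toReal) ∂μ ≤
        (S.c * RandomizedPD.E0sq P S x0 y0 xs ys
          + (M + ‖ys‖) * √(RandomizedPD.E0sq P S x0 y0 xs ys) * S.c * √(2 * S.c / S.ρ₀))
          / (k + S.c - 1)) ∧
    liminf (fun k : ℕ => ((k * √(Real.log k)
      * ∫ ω, ((P.F (x k ω)).toReal - P.Fstar.toReal) ∂μ : ℝ) : EReal)) atTop = 0 ∧
    RandomizedPD.SmallOLiminf
      (fun k => (∫ ω, (P.F (x k ω)).toReal ∂μ) - P.Fstar.toReal)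
      (fun k => 1 / (k * √(Real.log k))) := by
  obtain ⟨xs₀, hxs₀⟩ := hP.solution
  obtain ⟨ys₀, hys₀⟩ := hP.dualSolutions_nonempty hg hx0
  have hx0d := (hP.F_lt_top_iff hg).1 hx0
  have hiter : ∀ k ω, x k ω =
      (RandomizedPD.augIterate S x0 y0 (fun l => is l ω) (fun l => js l ω) k).1.x :=
    fun k ω => by rw [hx k ω, RandomizedPD.augIterate_fst]
  have hdom : ∀ k ω, x k ω ∈ P.dom := fun k ω => by
    rw [hiter]
    exact (RandomizedPD.augIterate_mem hP hS hβ hg hx0d y0 _ _ k).1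
  have hint : ∀ k, Integrable (fun ω => (P.F (x k ω)).toReal) μ := fun k => by
    simp only [hiter]
    exact RandomizedPD.integrable_augIterate hsamp (fun a => (P.F a.1.x).toReal) k
  have hpos : ∀ k, 0 ≤ ∫ ω, ((P.F (x k ω)).toReal - P.Fstar.toReal) ∂μ := fun k => by
    refine integral_nonneg fun ω => sub_nonneg.2 ?_
    rw [hP.F_eq hg (hdom k ω), EReal.toReal_coe]
    exact hP.Fstar_toReal_le hg hxs₀ (hP.mem_dom_of_primalSolutions hg hx0 hxs₀) (hdom k ω)
  have hkc : ∀ k : ℕ, 0 < (k : ℝ) + S.c - 1 := fun k => by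
    have : (0 : ℝ) ≤ k := by positivity
    linarith [hS.one_lt_c]
  have hc0 : 0 < S.c := by linarith [hS.one_lt_c]
  have hρ := hS.ρ₀_pos
  have hliminf : liminf (fun k : ℕ => ((k * √(Real.log k)
      * ∫ ω, ((P.F (x k ω)).toReal - P.Fstar.toReal) ∂μ : ℝ) : EReal)) atTop = 0 := by
    obtain ⟨A, U, hA0, hF, hA, -, hAs, hUs⟩ :=
      RandomizedPD.expected_gap_and_residual (y0 := y0) hP hS hβ hc hg hx0d hsamp hxs₀
        (hP.mem_dom_of_primalSolutions hg hx0 hxs₀)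
        (hP.isMultiplier_of_dualSolutions hg hx0 hys₀)
    simp only [← hiter] at hF
    refine RandomizedPD.liminf_coe_eq_zero
      (fun k => mul_nonneg (by positivity) (hpos k)) fun ε hε => ?_
    have hfreq := RandomizedPD.frequently_mul_sqrt_log_lt (a := A)
      (b := fun k => (M + ‖ys₀‖) * U k) (A := S.c * RandomizedPD.E0sq P S x0 y0 xs₀ ys₀) hA0 hAs
      (fun k => (mul_le_mul_of_nonneg_right (by linarith [hS.one_lt_c]) (hA0 k)).trans (hA k))
      ((hUs.mul_left ((M + ‖ys₀‖) ^ 2)).congr fun k => by ring) hε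
    exact hfreq.mono fun k hk =>
      (mul_le_mul_of_nonneg_left (hF k) (by positivity)).trans_lt hk
  refine ⟨fun k => ⟨Eventually.of_forall fun ω => (hP.F_lt_top_iff hg).2 (hdom k ω), hint k⟩,
    fun xs hxs ys hys k => ?_, hliminf, ?_⟩
  · obtain ⟨A, U, hA0, hF, hA, hU, -, -⟩ :=
      RandomizedPD.expected_gap_and_residual (y0 := y0) hP hS hβ hc hg hx0d hsamp hxs
        (hP.mem_dom_of_primalSolutions hg hx0 hxs)
        (hP.isMultiplier_of_dualSolutions hg hx0 hys)
    simp only [← hiter] at hF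
    set E := RandomizedPD.E0sq P S x0 y0 xs ys
    have hE : 0 ≤ E := nonneg_of_mul_nonneg_right
      ((mul_nonneg (hkc 0).le (hA0 0)).trans (hA 0)) hc0
    have hUk : (k + S.c - 1) * U k ≤ √E * S.c * √(2 * S.c / S.ρ₀) := by
      refine le_of_sq_le_sq ((hU k).trans ?_) (by positivity)
      rw [mul_pow, mul_pow, Real.sq_sqrt hE, Real.sq_sqrt (by positivity)]
      have h1 : 2 * S.c ^ 2 / S.ρ₀ * E * 1 ≤ 2 * S.c ^ 2 / S.ρ₀ * E * S.c :=
        mul_le_mul_of_nonneg_left hS.one_lt_c.le (by positivity)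
      calc _ ≤ 2 * S.c ^ 2 / S.ρ₀ * E * S.c := by linarith
        _ = _ := by ring
    rw [le_div_iff₀ (hkc k)]
    calc _ ≤ (A k + (M + ‖ys‖) * U k) * (k + S.c - 1) :=
          mul_le_mul_of_nonneg_right (hF k) (hkc k).le
      _ = (k + S.c - 1) * A k + (M + ‖ys‖) * ((k + S.c - 1) * U k) := by ring
      _ ≤ S.c * E + (M + ‖ys‖) * (√E * S.c * √(2 * S.c / S.ρ₀)) :=
          add_le_add (hA k) (mul_le_mul_of_nonneg_left hUk (by positivity))
      _ = _ := by ring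
  · rw [RandomizedPD.SmallOLiminf, ← hliminf]
    congr 1
    funext k
    rw [integral_sub (hint k) (integrable_const _), integral_const, probReal_univ, one_smul,
      div_div_eq_mul_div, div_one, mul_comm]
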